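/- Let $\Gamma$ be a primitive strongly regular graph with parameters $(v,k,\lambda,\mu)$, that is, a finite simple $k$-regular graph on $v$ vertices that is not complete, in which any two adjacent vertices have exactly $\lambda$ common neighbours and any two distinct non-adjacent vertices have exactly $\mu$ common neighbours, and such that both $\Gamma$ and its complement are connected. Assume that the smallest eigenvalue of the adjacency matrix of $\Gamma$ is $-m$, where $m$ is a positive integer, and put $$f(m,\mu)=\tfrac{8}{3}m(\mu-1)-\tfrac{2}{3}\mu+3m-\tfrac{10}{3}.$$ Then the following hold. (i) If $\mu=m(m-1)$ and $\lambda>f(m,\mu)$, then $\Gamma$ is the collinearity graph of a partial geometry $\mathrm{pg}(K,R,T)$ with $T=R-1$, and $\Gamma$ is a Latin square graph $\mathrm{LS}_m(\lambda-m(m-3))$. (ii) If $\mu=m^2$ and $\lambda>f(m,\mu)$, then $\Gamma$ is the collinearity graph of a partial geometry $\mathrm{pg}(K,R,T)$ with $T=R$, and $\Gamma$ is the block graph of a $2$-$(\lambda(m-1)-m(m-1)(m-2)+m,\,m,\,1)$ design. (iii) If $\mu\ne m(m-1)$ and $\mu\neq m^2$, then $\lambda\le f(m,\mu)$. Here a partial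 geometry $\mathrm{pg}(K,R,T)$, with $K,R>1$ and $T>0$, is an incidence structure of points and lines (both sets non-empty) in which two distinct points are on at most one common line, every line has exactly $K$ points, every point is on exactly $R$ lines, and for each line $L$ and each point $x\notin L$ exactly $T$ lines through $x$ meet $L$. Its collinearity graph has the points as vertices, distinct points being adjacent when they are on a common line. A Latin square graph $\mathrm{LS}_m(n)$ has as vertices the $n^2$ columns of an orthogonal array $\mathrm{OA}(m,n)$ (an $m\times n^2$ array with entries from an $n$-element set in which the $n^2$ ordered pairs formed by any two distinct rows are distinct), distinct columns being adjacent when they agree in some row. A $2$-$(w,m,1)$ design consists of $w$ points and a family of blocks of $m$ points each, $2\le m\le w$, such that any two distinct points are in exactly one block; its block graph has the blocks as vertices, distinct blocks being adjacent when they share a point. -/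

import Mathlib

namespace SRGBound

universe u

/-- A primitive strongly regular graph with parameters `(v, k, l, μ)`: a strongly regular graph
that is not complete, is connected, and has a connected complement. -/
structure IsPrimitiveSRG {V : Type u} [Fintype V] (G : SimpleGraph V) [DecidableRel G.Adj]
    (v k l μ : ℕ) : Prop where
  isSRGWith : G.IsSRGWith v k l μ
  ne_top : G ≠ ⊤
  connected : G.Connected
  compl_connected : Gᶜ.Connected

/-- `t` is the smallest eigenvalue of the adjacency matrix of `G`. -/
def IsSmallestEigenvalue {V : Type u} [Fintype V] [DecidableEq V] (G : SimpleGraph V)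
    [DecidableRel G.Adj] (t : ℝ) : Prop :=
  IsLeast {x : ℝ | Module.End.HasEigenvalue (Matrix.toLin' (G.adjMatrix ℝ)) x} t

/-- The incidence structure with point set `P`, line set `L` and incidence relation `I` is a
partial geometry `pg(K, R, T)`: a partial linear space with `K` points on each line, `R` lines on
each point and, for each line `a` and each point `p` not on `a`, exactly `T` lines through `p` that
meet `a`. As usual, `K, R > 1` and `T > 0`. -/
structure IsPartialGeometry {P L : Type u} (I : P → L → Prop) (K R T : ℕ) : Prop where
  one_lt_K : 1 < K
  one_lt_R : 1 < R
  T_pos : 0 < T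
  nonempty_points : Nonempty P
  nonempty_lines : Nonempty L
  line_unique : ∀ p q : P, p ≠ q → ∀ a b : L, I p a → I q a → I p b → I q b → a = b
  order_line : ∀ a : L, {p : P | I p a}.ncard = K
  order_point : ∀ p : P, {a : L | I p a}.ncard = R
  meeting : ∀ (a : L) (p : P), ¬ I p a → {b : L | I p b ∧ ∃ q : P, I q b ∧ I q a}.ncard = T

/-- The point graph (collinearity graph) of an incidence structure: distinct points are adjacent
when they lie on a common line. -/
def pointGraph {P L : Type u} (I : P → L → Prop) : SimpleGraph P where
  Adj p q := p ≠ q ∧ ∃ a : L, I p a ∧ I q a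
  symm := ⟨fun _ _ h => ⟨h.1.symm, h.2.imp fun _ ha => ⟨ha.2, ha.1⟩⟩⟩
  loopless := ⟨fun _ h => h.1 rfl⟩

/-- `G` is (isomorphic to) the collinearity graph of a partial geometry `pg(K, R, T)`. -/
def IsCollinearityGraph {V : Type u} (G : SimpleGraph V) (K R T : ℕ) : Prop :=
  ∃ (P L : Type u) (I : P → L → Prop),
    IsPartialGeometry I K R T ∧ Nonempty (G ≃g pointGraph I)

/-- An orthogonal array `OA(m, n)`: an `m × n²` array with entries from an `n`-element set such
that the `n²` ordered pairs formed by any two distinct rows are distinct. -/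
def IsOrthogonalArray {m n : ℕ} (A : Fin m → Fin (n ^ 2) → Fin n) : Prop :=
  ∀ i j : Fin m, i ≠ j → Function.Injective fun c => (A i c, A j c)

/-- The graph on the columns of an array in which distinct columns are adjacent when they agree in
some row. -/
def columnGraph {m n : ℕ} (A : Fin m → Fin (n ^ 2) → Fin n) : SimpleGraph (Fin (n ^ 2)) where
  Adj c d := c ≠ d ∧ ∃ i : Fin m, A i c = A i d
  symm := ⟨fun _ _ h => ⟨h.1.symm, h.2.imp fun _ hi => hi.symm⟩⟩
  loopless := ⟨fun _ h => h.1 rfl⟩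

/-- `G` is a Latin square graph `LS_m(n)`: the column graph of an orthogonal array `OA(m, n)`. -/
def IsLatinSquareGraph {V : Type u} (G : SimpleGraph V) (m n : ℕ) : Prop :=
  ∃ A : Fin m → Fin (n ^ 2) → Fin n, IsOrthogonalArray A ∧ Nonempty (G ≃g columnGraph A)

/-- The incidence structure with point set `P`, block set `B` and incidence relation `I` is a
`2-(v, k, l)` design: there are `v` points, each block has `k` points, where `2 ≤ k ≤ v`, and any
two distinct points are on exactly `l` common blocks. -/
structure IsTwoDesign {P B : Type u} (I : P → B → Prop) (v k l : ℕ) : Prop where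
  two_le : 2 ≤ k
  le_card : k ≤ v
  card_points : Nat.card P = v
  card_block : ∀ b : B, {p : P | I p b}.ncard = k
  balanced : ∀ p q : P, p ≠ q → {b : B | I p b ∧ I q b}.ncard = l

/-- The block graph of an incidence structure: distinct blocks are adjacent when they share a
point. -/
def blockGraph {P B : Type u} (I : P → B → Prop) : SimpleGraph B where
  Adj b c := b ≠ c ∧ ∃ p : P, I p b ∧ I p c
  symm := ⟨fun _ _ h => ⟨h.1.symm, h.2.imp fun _ hp => ⟨hp.2, hp.1⟩⟩⟩
  loopless := ⟨fun _ h => h.1 rfl⟩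

/-- `G` is (isomorphic to) the block graph of a `2-(v, k, l)` design. -/
def IsBlockGraph {V : Type u} (G : SimpleGraph V) (v k l : ℕ) : Prop :=
  ∃ (P B : Type u) (I : P → B → Prop), IsTwoDesign I v k l ∧ Nonempty (G ≃g blockGraph I)

/-- The bound `f(m, μ) = (8/3) m (μ - 1) - (2/3) μ + 3 m - 10/3`. -/
noncomputable def f (m μ : ℕ) : ℝ :=
  8 / 3 * (m : ℝ) * ((μ : ℝ) - 1) - 2 / 3 * (μ : ℝ) + 3 * (m : ℝ) - 10 / 3

end SRGBound

/-! ### Claws, and Metsch's construction of lines from large cliques -/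

namespace SRGBound

open Finset

variable {V : Type*} [Fintype V] [DecidableEq V] {G : SimpleGraph V} [DecidableRel G.Adj]

/-! Suppose `l` exceeds `f m μ`. The claim is that the graph is then geometric, with `T = R - 1` or
`T = R`; everything else is bookkeeping.

Combinatorics: inclusion–exclusion in the neighbourhood of a vertex (`claw_bound`) shows that a claw
has at most `s = ⌊4m/3⌋` leaves. Metsch's argument (`exists_lineSystem`) then shows that the large
maximal cliques serve as lines: every edge lies in exactly one of them and every vertex in at most
`s`.

Spectrum: by the Delsarte bound a line has at most `k/m + 1` vertices, so each vertex is on at least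
`m` lines. If more vertices than lines were on more than `m` lines, some nonzero vector supported on
those vertices would have all line sums zero, against `A + mI ≥ 0` (`card_irregular_le`). As lines
are long, they are few; hence some vertex is on exactly `m` lines, its lines meet the Delsarte
bound, and `m ∣ μ` (`dvd_mu`). Now `μ ≥ m`, which makes the lines long enough for `card_lines_eq`:
the remaining bad vertices would induce a subgraph whose degrees are too large for so small a set.
So all vertices are on `m` lines, all lines are Delsarte cliques, and the geometry is a `pg(K, m,
μ/m)`.

Partial geometry: if `T ≤ R - 2`, the Krein condition (for `2T < R`) or the absolute bound (for `R ≤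
2T`), applied to the graph on the lines, gives `K ≤ 2R²T` (`K_le`), which contradicts the size of
`l`. The case `T = R - 1` is a net, hence an orthogonal array; the case `T = R` is a dual design. -/

/-- Two non-adjacent neighbours of `x` have at most `X` common neighbours inside the neighbourhood
of `x`, if non-adjacent vertices have at most `X + 1` common neighbours. -/
theorem card_local_common_le {X : ℕ}
    (hμ : ∀ x y, x ≠ y → ¬ G.Adj x y → (G.neighborFinset x ∩ G.neighborFinset y).card ≤ X + 1)
    {x y z : V} (hy : G.Adj x y) (hz : G.Adj x z) (hyz : y ≠ z) (hn : ¬ G.Adj y z) :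
    (G.neighborFinset x ∩ (G.neighborFinset y ∩ G.neighborFinset z)).card ≤ X := by
  have h1 : G.neighborFinset x ∩ (G.neighborFinset y ∩ G.neighborFinset z) ⊆
      (G.neighborFinset y ∩ G.neighborFinset z).erase x := by
    intro w hw
    simp only [mem_inter, SimpleGraph.mem_neighborFinset, mem_erase] at hw ⊢
    exact ⟨fun h => G.loopless.irrefl x (h ▸ hw.1), hw.2⟩
  have hx : x ∈ G.neighborFinset y ∩ G.neighborFinset z := by
    simp [hy.symm, hz.symm]
  have h2 := card_le_card h1
  rw [card_erase_of_mem hx] at h2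
  have := hμ y z hyz hn
  omega

/-- The claw bound: an independent set of size `t` in the neighbourhood of a vertex. -/
theorem claw_bound {k l X : ℕ} (hk : ∀ x, (G.neighborFinset x).card = k)
    (hl : ∀ x y, G.Adj x y → (G.neighborFinset x ∩ G.neighborFinset y).card = l)
    (hμ : ∀ x y, x ≠ y → ¬ G.Adj x y → (G.neighborFinset x ∩ G.neighborFinset y).card ≤ X + 1)
    (x : V) (I : Finset V) (hI : ∀ y ∈ I, G.Adj x y) (hind : ∀ y ∈ I, ∀ z ∈ I, ¬ G.Adj y z) :
    2 * (I.card : ℤ) * (l + 1) ≤ 2 * k + I.card * (I.card - 1) * X := by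
  -- These sets have `l + 1` elements each, lie in the neighbourhood of `x` and pairwise share at
  -- most `X` vertices. Adding them one at a time gives the truncated inclusion–exclusion bound for
  -- their union, which has at most `k` elements.
  let P : V → Finset V := fun y => insert y (G.neighborFinset x ∩ G.neighborFinset y)
  have hP : ∀ y ∈ I, P y ⊆ G.neighborFinset x := by
    intro y hy w hw
    rcases mem_insert.1 hw with rfl | h
    · simpa using hI _ hy
    · exact (mem_inter.1 h).1
  have key : ∀ J : Finset V, J ⊆ I →
      2 * (J.card : ℤ) * (l + 1) ≤ 2 * (J.biUnion P).card + J.card * (J.card - 1) * X := by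
    intro J
    induction J using Finset.induction_on with
    | empty => intro _; simp
    | insert y J hyJ ih =>
      intro hJ
      have ih' := ih (fun z hz => hJ (mem_insert_of_mem hz))
      have hyI := hJ (mem_insert_self y J)
      have hPy : (P y).card = l + 1 := by
        rw [card_insert_of_notMem (by simp), hl x y (hI y hyI)]
      have hint : (P y ∩ J.biUnion P).card ≤ J.card * X := by
        rw [inter_biUnion]
        apply card_biUnion_le_card_mul
        intro z hz
        have hzI := hJ (mem_insert_of_mem hz)
        have hne : y ≠ z := fun h => hyJ (h ▸ hz)
        refine le_trans (card_le_card ?_)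
          (card_local_common_le hμ (hI y hyI) (hI z hzI) hne (hind y hyI z hzI))
        intro w hw
        simp only [P, mem_inter, mem_insert, SimpleGraph.mem_neighborFinset] at hw ⊢
        have h1 := hind y hyI z hzI
        have h2 := hind z hzI y hyI
        rcases hw with ⟨rfl | ha, rfl | hb⟩
        · exact absurd rfl hne
        · exact absurd hb.2 h2
        · exact absurd ha.2 h1
        · exact ⟨ha.1, ha.2, hb.2⟩
      have hu := card_union_add_card_inter (P y) (J.biUnion P)
      rw [biUnion_insert, card_insert_of_notMem hyJ]
      have hu' : ((P y ∪ J.biUnion P).card : ℤ) + J.card * X ≥ l + 1 + (J.biUnion P).card := by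
        rw [hPy] at hu
        zify at hu hint
        linarith
      push_cast
      nlinarith
  have h1 := key I (Subset.refl _)
  have h2 : (I.biUnion P).card ≤ k := by
    rw [← hk x]
    exact card_le_card (biUnion_subset.2 hP)
  zify at h2
  linarith

/-- A clique that is maximal with respect to inclusion. -/
def MaxClique (G : SimpleGraph V) (c : Finset V) : Prop :=
  (∀ y ∈ c, ∀ z ∈ c, y ≠ z → G.Adj y z) ∧ ∀ q, q ∉ c → ∃ w ∈ c, ¬ G.Adj q w

omit [DecidableRel G.Adj] in
theorem exists_maxClique_superset (c : Finset V) (hc : ∀ y ∈ c, ∀ z ∈ c, y ≠ z → G.Adj y z) :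
    ∃ d, MaxClique G d ∧ c ⊆ d := by
  classical
  obtain ⟨d, hd, hmax⟩ := Finset.exists_max_image
    (univ.filter fun d : Finset V => c ⊆ d ∧ ∀ y ∈ d, ∀ z ∈ d, y ≠ z → G.Adj y z) card
    ⟨c, by simpa using hc⟩
  simp only [mem_filter, mem_univ, true_and] at hd hmax
  refine ⟨d, ⟨hd.2, fun q hq => ?_⟩, hd.1⟩
  by_contra! hcon
  have := hmax (insert q d) ⟨hd.1.trans (subset_insert _ _), by
    intro y hy z hz hyz
    rcases mem_insert.1 hy with rfl | hy'
    · exact hcon z ((mem_insert.1 hz).resolve_left hyz.symm)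
    · rcases mem_insert.1 hz with rfl | hz'
      · exact (hcon y hy').symm
      · exact hd.2 y hy' z hz' hyz⟩
  rw [card_insert_of_notMem hq] at this
  omega

/-- A neighbour of `x` outside a maximal clique on `x` has few neighbours in that clique. -/
theorem card_neighbor_maxClique_le {X : ℕ}
    (hμ : ∀ x y, x ≠ y → ¬ G.Adj x y → (G.neighborFinset x ∩ G.neighborFinset y).card ≤ X + 1)
    {x z : V} {c : Finset V} (hc : MaxClique G c) (hx : x ∈ c) (hz : G.Adj x z) (hzc : z ∉ c) :
    ((c.erase x).filter fun w => G.Adj z w).card ≤ X := by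
  obtain ⟨w, hw, hzw⟩ := hc.2 z hzc
  have hxw : w ≠ x := by rintro rfl; exact hzw hz.symm
  have hwz : w ≠ z := by rintro rfl; exact hzc hw
  refine le_trans (card_le_card ?_) (card_local_common_le hμ hz (hc.1 x hx w hw hxw.symm)
    hwz.symm hzw)
  intro u hu
  simp only [mem_filter, mem_erase, mem_inter, SimpleGraph.mem_neighborFinset] at hu ⊢
  exact ⟨hc.1 x hx u hu.1.2 hu.1.1.symm, hu.2,
    hc.1 w hw u hu.1.2 (fun h => hzw (h ▸ hu.2))⟩

/-- If claws have size at most `s` and `l + 1 > (2s - 1)X`, then the neighbours of a vertex are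
covered by at most `s` large maximal cliques. -/
theorem exists_local_cover {l X s : ℕ}
    (hl : ∀ x y, G.Adj x y → (G.neighborFinset x ∩ G.neighborFinset y).card = l)
    (hμ : ∀ x y, x ≠ y → ¬ G.Adj x y → (G.neighborFinset x ∩ G.neighborFinset y).card ≤ X + 1)
    (hs : 2 * s * X < l + 1 + X)
    (hclaw : ∀ x, ∀ I : Finset V, (∀ y ∈ I, G.Adj x y) → (∀ y ∈ I, ∀ z ∈ I, ¬ G.Adj y z) →
      I.card ≤ s) (x : V) :
    ∃ F : Finset (Finset V), F.card ≤ s ∧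
      (∀ c ∈ F, MaxClique G c ∧ x ∈ c ∧ l + 2 + X ≤ c.card + s * X) ∧
      ∀ z, G.Adj x z → ∃ c ∈ F, z ∈ c := by
  obtain ⟨I, hI, hmax⟩ := Finset.exists_max_image
    (univ.filter fun I : Finset V => (∀ y ∈ I, G.Adj x y) ∧ ∀ y ∈ I, ∀ z ∈ I, ¬ G.Adj y z) card
    ⟨∅, by simp⟩
  simp only [mem_filter, mem_univ, true_and] at hI hmax
  obtain ⟨hIx, hind⟩ := hI
  have hIs := hclaw x I hIx hind
  -- `Q i` collects the neighbours of `x` that could replace `i` in the maximum independent set `I`.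
  -- Two non-adjacent members replacing `i` together would enlarge `I`, so `Q i` is a clique.
  let Q : V → Finset V := fun i =>
    (G.neighborFinset x).filter fun z => ∀ j ∈ I, j ≠ i → z ≠ j ∧ ¬ G.Adj z j
  have hQx : ∀ i, ∀ z ∈ Q i, G.Adj x z := fun i z hz => by
    simpa using (mem_filter.1 hz).1
  have hQcl : ∀ i ∈ I, ∀ y ∈ Q i, ∀ z ∈ Q i, y ≠ z → G.Adj y z := by
    intro i hi y hy z hz hyz
    by_contra hn
    have hy2 := (mem_filter.1 hy).2
    have hz2 := (mem_filter.1 hz).2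
    have hyI : y ∉ insert z (I.erase i) := by
      intro h
      rcases mem_insert.1 h with h | h
      · exact hyz h
      · exact (hy2 y (mem_of_mem_erase h) (ne_of_mem_erase h)).1 rfl
    have hzI : z ∉ I.erase i := fun h =>
      (hz2 z (mem_of_mem_erase h) (ne_of_mem_erase h)).1 rfl
    have := hmax (insert y (insert z (I.erase i))) ⟨by
      intro w hw
      simp only [mem_insert, mem_erase] at hw
      rcases hw with rfl | rfl | hw
      · exact hQx i _ hy
      · exact hQx i _ hz
      · exact hIx w hw.2, by
      intro a ha b hb
      simp only [mem_insert, mem_erase] at ha hb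
      rcases ha with rfl | rfl | ha <;> rcases hb with rfl | rfl | hb
      · exact G.loopless.irrefl _
      · exact hn
      · exact (hy2 b hb.2 hb.1).2
      · exact fun h => hn h.symm
      · exact G.loopless.irrefl _
      · exact (hz2 b hb.2 hb.1).2
      · exact fun h => (hy2 a ha.2 ha.1).2 h.symm
      · exact fun h => (hz2 a ha.2 ha.1).2 h.symm
      · exact hind a ha.2 b hb.2⟩
    rw [card_insert_of_notMem hyI, card_insert_of_notMem hzI, card_erase_of_mem hi] at this
    have : 0 < I.card := card_pos.2 ⟨i, hi⟩
    omega
  -- Of the `l + 1` vertices formed by `i` and its common neighbours with `x`, each other `j ∈ I`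
  -- excludes at most `X` from `Q i`.
  have hQcard : ∀ i ∈ I, l + 1 + X ≤ (Q i).card + I.card * X := by
    intro i hi
    have h1 : insert i (G.neighborFinset x ∩ G.neighborFinset i) ⊆ Q i ∪
        (I.erase i).biUnion fun j =>
          G.neighborFinset x ∩ (G.neighborFinset i ∩ G.neighborFinset j) := by
      intro w hw
      by_cases hwQ : w ∈ Q i
      · exact mem_union_left _ hwQ
      refine mem_union_right _ ?_
      simp only [mem_insert, mem_inter, SimpleGraph.mem_neighborFinset] at hw
      have hxw : G.Adj x w := by
        rcases hw with rfl | h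
        · exact hIx _ hi
        · exact h.1
      simp only [Q, mem_filter, SimpleGraph.mem_neighborFinset, hxw, true_and] at hwQ
      push Not at hwQ
      obtain ⟨j, hj, hji, hwj⟩ := hwQ
      have hwi : w ≠ i := by
        rintro rfl
        exact hind _ hi _ hj (hwj hji.symm)
      have hiw : G.Adj i w := (hw.resolve_left hwi).2
      have hwj' : w ≠ j := by
        rintro rfl
        exact hind _ hi _ hj hiw
      simp only [mem_biUnion, mem_erase, mem_inter, SimpleGraph.mem_neighborFinset]
      exact ⟨j, ⟨hji, hj⟩, hxw, hiw, (hwj hwj').symm⟩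
    have h2 := (card_le_card h1).trans (card_union_le _ _)
    rw [card_insert_of_notMem (by simp), hl x i (hIx i hi)] at h2
    have h3 : ((I.erase i).biUnion fun j =>
          G.neighborFinset x ∩ (G.neighborFinset i ∩ G.neighborFinset j)).card ≤
          (I.erase i).card * X := by
      apply card_biUnion_le_card_mul
      intro j hj
      rw [mem_erase] at hj
      exact card_local_common_le hμ (hIx i hi) (hIx j hj.2) hj.1.symm (hind i hi j hj.2)
    have h4 := card_erase_add_one hi
    have h5 : I.card * X = (I.erase i).card * X + X := by rw [← h4]; ring
    omega
  have hext : ∀ i, ∃ d : Finset V, i ∈ I → MaxClique G d ∧ insert x (Q i) ⊆ d := by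
    intro i
    by_cases hi : i ∈ I
    · obtain ⟨d, h1, h2⟩ := exists_maxClique_superset (G := G) (insert x (Q i)) (by
        intro y hy z hz hyz
        rcases mem_insert.1 hy with rfl | hy'
        · exact hQx i z ((mem_insert.1 hz).resolve_left hyz.symm)
        · rcases mem_insert.1 hz with rfl | hz'
          · exact (hQx i y hy').symm
          · exact hQcl i hi y hy' z hz' hyz)
      exact ⟨d, fun _ => ⟨h1, h2⟩⟩
    · exact ⟨∅, fun h => absurd h hi⟩
  choose L hL using hext
  have hxL : ∀ i ∈ I, x ∈ L i := fun i hi => (hL i hi).2 (mem_insert_self _ _)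
  have hQL : ∀ i ∈ I, ∀ w ∈ Q i, w ∈ L i := fun i hi w hw => (hL i hi).2 (mem_insert_of_mem hw)
  have hxQ : ∀ i, x ∉ Q i := fun i h => G.loopless.irrefl x (hQx i x h)
  have hiQ : ∀ i ∈ I, i ∈ Q i := by
    intro i hi
    simp only [Q, mem_filter, SimpleGraph.mem_neighborFinset]
    exact ⟨hIx i hi, fun j hj hji => ⟨hji.symm, hind i hi j hj⟩⟩
  have hQL' : ∀ i ∈ I, ∀ j ∈ I, j ≠ i → ∀ w ∈ Q j, w ∉ L i := by
    intro i hi j hj hji w hw hwL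
    have h := (mem_filter.1 hw).2 i hi hji.symm
    exact h.2 ((hL i hi).1.1 w hwL i (hQL i hi i (hiQ i hi)) h.1)
  refine ⟨I.image L, card_image_le.trans hIs, ?_, ?_⟩
  · intro c hc
    obtain ⟨i, hi, rfl⟩ := mem_image.1 hc
    refine ⟨(hL i hi).1, hxL i hi, ?_⟩
    have h1 := card_le_card (hL i hi).2
    rw [card_insert_of_notMem (hxQ i)] at h1
    have h2 := hQcard i hi
    have h3 := Nat.mul_le_mul_right X hIs
    omega
  · intro z hz
    by_contra! hcon
    have hzL : ∀ i ∈ I, z ∉ L i := fun i hi => hcon _ (mem_image_of_mem _ hi)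
    -- Starting from an uncovered `z`, choose greedily one vertex from each `Q i`, independent of
    -- those chosen before; this ends with `I.card + 1` independent neighbours of `x`.
    have key : ∀ J : Finset V, J ⊆ I → ∃ W : Finset V, W.card = J.card + 1 ∧
        (∀ w ∈ W, G.Adj x w) ∧ (∀ a ∈ W, ∀ b ∈ W, ¬ G.Adj a b) ∧
        ∀ w ∈ W, ∀ i ∈ I, i ∉ J → w ∉ L i := by
      intro J
      induction J using Finset.induction_on with
      | empty =>
        intro _
        refine ⟨{z}, by simp, by simpa using hz, by simp, ?_⟩
        intro w hw i hi _
        rw [mem_singleton.1 hw]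
        exact hzL i hi
      | insert i J hiJ ih =>
        intro hJ
        obtain ⟨W, hW1, hW2, hW3, hW4⟩ := ih (fun z hz => hJ (mem_insert_of_mem hz))
        have hi := hJ (mem_insert_self i J)
        have hJI : J.card + 1 ≤ I.card := by
          rw [← card_insert_of_notMem hiJ]; exact card_le_card hJ
        have hbad : (W.biUnion fun a => ((L i).erase x).filter fun w => G.Adj a w).card
            ≤ W.card * X := by
          apply card_biUnion_le_card_mul
          intro a ha
          exact card_neighbor_maxClique_le hμ (hL i hi).1 (hxL i hi) (hW2 a ha) (hW4 a ha i hi hiJ)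
        -- The at most `s` vertices chosen so far lie outside `L i`, so each forbids at most `X`
        -- choices; `hs` leaves a member of `Q i`.
        obtain ⟨w, hwQ, hw⟩ : ∃ w ∈ Q i, w ∉
            (W.biUnion fun a => ((L i).erase x).filter fun w => G.Adj a w) := by
          apply exists_mem_notMem_of_card_lt_card
          have h2 := hQcard i hi
          have h3 : I.card * X ≤ s * X := Nat.mul_le_mul_right X hIs
          have h4 : W.card * X ≤ I.card * X := Nat.mul_le_mul_right X (hW1 ▸ hJI)
          have h5 : 2 * s * X = s * X + s * X := by ring
          omega
        have hwW : ∀ a ∈ W, ¬ G.Adj a w := by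
          intro a ha haw
          apply hw
          rw [mem_biUnion]
          refine ⟨a, ha, mem_filter.2 ⟨mem_erase.2 ⟨?_, hQL i hi w hwQ⟩, haw⟩⟩
          rintro rfl
          exact hxQ i hwQ
        have hwW' : w ∉ W := fun h => hW4 w h i hi hiJ (hQL i hi w hwQ)
        refine ⟨insert w W, ?_, ?_, ?_, ?_⟩
        · rw [card_insert_of_notMem hwW', card_insert_of_notMem hiJ, hW1]
        · intro a ha
          rcases mem_insert.1 ha with rfl | ha
          · exact hQx i _ hwQ
          · exact hW2 a ha
        · intro a ha b hb
          rcases mem_insert.1 ha with rfl | ha' <;> rcases mem_insert.1 hb with rfl | hb'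
          · exact G.loopless.irrefl _
          · exact fun h => hwW b hb' h.symm
          · exact hwW a ha'
          · exact hW3 a ha' b hb'
        · intro a ha j hj hjJ
          rw [mem_insert, not_or] at hjJ
          rcases mem_insert.1 ha with rfl | ha
          · exact hQL' j hj i hi (Ne.symm hjJ.1) _ hwQ
          · exact hW4 a ha j hj hjJ.2
    obtain ⟨W, hW1, hW2, hW3, -⟩ := key I (Subset.refl _)
    have := hmax W ⟨hW2, hW3⟩
    omega

/-- A family of maximal cliques such that every edge is in exactly one member. -/
structure LineSystem (G : SimpleGraph V) (F : Finset (Finset V)) : Prop where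
  maxClique : ∀ c ∈ F, MaxClique G c
  cover : ∀ x y, G.Adj x y → ∃ c ∈ F, x ∈ c ∧ y ∈ c
  unique : ∀ x y, x ≠ y → ∀ c ∈ F, ∀ d ∈ F, x ∈ c → y ∈ c → x ∈ d → y ∈ d → c = d

/-- Metsch's theorem for graphs with constant `l`. -/
theorem exists_lineSystem {l X s : ℕ}
    (hl : ∀ x y, G.Adj x y → (G.neighborFinset x ∩ G.neighborFinset y).card = l)
    (hμ : ∀ x y, x ≠ y → ¬ G.Adj x y → (G.neighborFinset x ∩ G.neighborFinset y).card ≤ X + 1)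
    (hs : 2 * s * X < l + 1 + X)
    (hclaw : ∀ x, ∀ I : Finset V, (∀ y ∈ I, G.Adj x y) → (∀ y ∈ I, ∀ z ∈ I, ¬ G.Adj y z) →
      I.card ≤ s) :
    ∃ F : Finset (Finset V), LineSystem G F ∧ (∀ c ∈ F, l + 2 + X ≤ c.card + s * X) ∧
      ∀ x, (F.filter fun c => x ∈ c).card ≤ s := by
  classical
  have hloc := exists_local_cover hl hμ hs hclaw
  let F : Finset (Finset V) := univ.filter fun c => MaxClique G c ∧ l + 2 + X ≤ c.card + s * X
  have hF : ∀ c, c ∈ F ↔ MaxClique G c ∧ l + 2 + X ≤ c.card + s * X := by simp [F]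
  have huniq : ∀ x y, x ≠ y → ∀ c ∈ F, ∀ d ∈ F, x ∈ c → y ∈ c → x ∈ d → y ∈ d → c = d := by
    intro x y hxy c hc d hd hxc hyc hxd hyd
    by_contra hcd
    rw [hF] at hc hd
    obtain ⟨a, hac, had⟩ : ∃ a ∈ c, a ∉ d := by
      by_contra! hsub
      apply hcd
      refine Subset.antisymm hsub fun b hb => ?_
      by_contra hbc
      obtain ⟨w, hw, hbw⟩ := hc.1.2 b hbc
      exact hbw (hd.1.1 b hb w (hsub w hw) (fun h => hbc (h ▸ hw)))
    obtain ⟨b, hbd, hab⟩ := hd.1.2 a had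
    have hab' : a ≠ b := fun h => had (h ▸ hbd)
    -- All of `c ∩ d` is adjacent to the non-adjacent pair `a`, `b`, while `c ∪ d` lies in `x`, `y`
    -- and their common neighbours. Then `c.card + d.card ≤ l + X + 3`, which `hs` forbids for two
    -- large cliques.
    have h1 : (c ∩ d).card ≤ X + 1 := by
      refine le_trans (card_le_card ?_) (hμ a b hab' hab)
      intro w hw
      rw [mem_inter] at hw
      simp only [mem_inter, SimpleGraph.mem_neighborFinset]
      have haw : a ≠ w := fun h => had (h ▸ hw.2)
      have haw2 := hc.1.1 a hac w hw.1 haw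
      exact ⟨haw2, hd.1.1 b hbd w hw.2 (fun h => hab (h ▸ haw2))⟩
    have h2 : (c ∪ d).card ≤ l + 2 := by
      rw [← hl x y (hc.1.1 x hxc y hyc hxy)]
      have : c ∪ d ⊆ insert x (insert y (G.neighborFinset x ∩ G.neighborFinset y)) := by
        intro w hw
        simp only [mem_insert, mem_inter, SimpleGraph.mem_neighborFinset]
        by_cases hwx : w = x
        · exact Or.inl hwx
        by_cases hwy : w = y
        · exact Or.inr (Or.inl hwy)
        refine Or.inr (Or.inr ?_)
        rcases mem_union.1 hw with hw | hw
        · exact ⟨hc.1.1 x hxc w hw (Ne.symm hwx), hc.1.1 y hyc w hw (Ne.symm hwy)⟩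
        · exact ⟨hd.1.1 x hxd w hw (Ne.symm hwx), hd.1.1 y hyd w hw (Ne.symm hwy)⟩
      refine (card_le_card this).trans ((card_insert_le _ _).trans ?_)
      have := card_insert_le y (G.neighborFinset x ∩ G.neighborFinset y)
      omega
    have h3 := card_union_add_card_inter c d
    have h4 : 2 * s * X = s * X + s * X := by ring
    omega
  have hcov : ∀ x y, G.Adj x y → ∃ c ∈ F, x ∈ c ∧ y ∈ c := by
    intro x y hxy
    obtain ⟨E, -, h2, h3⟩ := hloc x
    obtain ⟨c, hc, hyc⟩ := h3 y hxy
    exact ⟨c, (hF c).2 ⟨(h2 c hc).1, (h2 c hc).2.2⟩, (h2 c hc).2.1, hyc⟩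
  refine ⟨F, ⟨fun c hc => ((hF c).1 hc).1, hcov, huniq⟩, fun c hc => ((hF c).1 hc).2, ?_⟩
  intro x
  obtain ⟨E, h1, h2, h3⟩ := hloc x
  refine (card_le_card ?_).trans h1
  intro c hc
  rw [mem_filter] at hc
  -- A second point `z` of `c` is covered by a clique of `E`, which by uniqueness is `c` itself; so
  -- all lines on `x` are among `E`.
  have hbig : 1 < c.card := by
    have := ((hF c).1 hc.1).2
    have h4 : 2 * s * X = s * X + s * X := by ring
    omega
  obtain ⟨z, hz, hzx⟩ := exists_mem_ne hbig x
  obtain ⟨d, hd, hzd⟩ := h3 z (((hF c).1 hc.1).1.1 x hc.2 z hz hzx.symm)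
  rwa [huniq x z hzx.symm c hc.1 d ((hF d).2 ⟨(h2 d hd).1, (h2 d hd).2.2⟩) hc.2 hz
    (h2 d hd).2.1 hzd]

end SRGBound

/-! ### Eigenvalue identities and the Delsarte bound -/

namespace SRGBound

open Finset

variable {V : Type*} [Fintype V] [DecidableEq V] {G : SimpleGraph V} [DecidableRel G.Adj]

/-- The sum of `u` over the neighbours of `x`. -/
def nbrSum (G : SimpleGraph V) [DecidableRel G.Adj] (u : V → ℝ) (x : V) : ℝ :=
  ∑ y ∈ G.neighborFinset x, u y

omit [DecidableEq V] in
theorem nbrSum_eq (u : V → ℝ) (x : V) :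
    nbrSum G u x = ∑ y, if G.Adj x y then u y else 0 := by
  rw [nbrSum, ← sum_filter]
  congr 1
  ext y
  simp

omit [DecidableEq V] in
theorem sum_mul_nbrSum (u w : V → ℝ) :
    ∑ x, u x * nbrSum G w x = ∑ x, nbrSum G u x * w x := by
  simp only [nbrSum_eq, mul_sum, sum_mul]
  rw [sum_comm]
  refine sum_congr rfl fun x _ => sum_congr rfl fun y _ => ?_
  simp [G.adj_comm x y]

omit [DecidableEq V] in
theorem sum_nbrSum {k : ℕ} (hk : ∀ x, (G.neighborFinset x).card = k) (u : V → ℝ) :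
    ∑ x, nbrSum G u x = k * ∑ x, u x := by
  have h := sum_mul_nbrSum (G := G) (fun _ => 1) u
  simp only [one_mul] at h
  rw [h, mul_sum]
  refine sum_congr rfl fun x _ => ?_
  simp [nbrSum, hk x]

/-- Entries of `A²` count common neighbours, so this is `A² = kI + lA + μ(J - I - A)` applied to
`u`. -/
theorem nbrSum_nbrSum {k l μ : ℕ} (hk : ∀ x, (G.neighborFinset x).card = k)
    (hl : ∀ x y, G.Adj x y → (G.neighborFinset x ∩ G.neighborFinset y).card = l)
    (hμ : ∀ x y, x ≠ y → ¬ G.Adj x y → (G.neighborFinset x ∩ G.neighborFinset y).card = μ)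
    (u : V → ℝ) (x : V) :
    nbrSum G (nbrSum G u) x =
      k * u x + l * nbrSum G u x + μ * ((∑ y, u y) - u x - nbrSum G u x) := by
  have h1 : nbrSum G (nbrSum G u) x =
      ∑ z, ((G.neighborFinset x ∩ G.neighborFinset z).card : ℝ) * u z := by
    rw [nbrSum_eq]
    simp only [nbrSum_eq]
    have : ∀ y, (if G.Adj x y then ∑ z, (if G.Adj y z then u z else 0) else 0) =
        ∑ z, if G.Adj x y ∧ G.Adj y z then u z else 0 := by
      intro y
      by_cases h : G.Adj x y <;> simp [h]
    simp only [this]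
    rw [sum_comm]
    refine sum_congr rfl fun z _ => ?_
    rw [← sum_filter, sum_const, nsmul_eq_mul]
    congr 3
    ext y
    simp [G.adj_comm z y]
  have h2 : ∀ z, ((G.neighborFinset x ∩ G.neighborFinset z).card : ℝ) * u z =
      (if x = z then ((k : ℝ) - μ) * u x else 0) + ((l : ℝ) - μ) * (if G.Adj x z then u z else 0)
        + μ * u z := by
    intro z
    by_cases hxz : x = z
    · subst hxz
      simp [hk x]
      ring
    · by_cases ha : G.Adj x z
      · simp [hxz, ha, hl x z ha]; ring
      · simp [hxz, ha, hμ x z hxz ha]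
  rw [h1]
  simp only [h2, sum_add_distrib, ← mul_sum, ← nbrSum_eq, sum_ite_eq, mem_univ, if_true]
  ring

/-- The combinatorial and spectral data of a strongly regular graph with smallest eigenvalue `-m`
that are used below. -/
structure SpectralData (G : SimpleGraph V) [DecidableRel G.Adj] (k l μ m : ℕ) : Prop where
  card_nbr : ∀ x, (G.neighborFinset x).card = k
  card_adj : ∀ x y, G.Adj x y → (G.neighborFinset x ∩ G.neighborFinset y).card = l
  card_not_adj : ∀ x y, x ≠ y → ¬ G.Adj x y →
    (G.neighborFinset x ∩ G.neighborFinset y).card = μ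
  nonempty : Nonempty V
  two_le : 2 ≤ m
  mu_pos : 0 < μ
  k_eq : (k : ℝ) = μ + m * (l - μ + m)
  psd : ∀ u : V → ℝ, 0 ≤ ∑ x, u x * nbrSum G u x + m * ∑ x, u x ^ 2
  mu_le : μ ≤ l

namespace SpectralData

variable {k l μ m : ℕ} (h : SpectralData G k l μ m)
include h

theorem k_pos : 0 < k := by
  have h1 := h.k_eq
  have h2 : (μ : ℝ) ≤ l := by exact_mod_cast h.mu_le
  have h3 : (0 : ℝ) < μ := by exact_mod_cast h.mu_pos
  have h4 : (0 : ℝ) ≤ m * (l - μ + m) := by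
    have : (0 : ℝ) ≤ m := by positivity
    apply mul_nonneg <;> linarith
  have : (0 : ℝ) < k := by linarith
  exact_mod_cast this

/-- The identity for `A²` on the all-ones vector, rewritten with `k_eq`. Here and below `θ = l - μ +
m` is the other restricted eigenvalue. -/
theorem card_eq : (μ : ℝ) * Fintype.card V = (k + m) * (k - (l - μ + m)) := by
  obtain ⟨x⟩ := h.nonempty
  have h1 := nbrSum_nbrSum h.card_nbr h.card_adj h.card_not_adj (fun _ => 1) x
  have h2 : ∀ x, nbrSum G (fun _ => 1) x = k := by
    intro x
    simp [nbrSum, h.card_nbr x]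
  have h3 : nbrSum G (nbrSum G (fun _ => 1)) x = k * k := by
    rw [nbrSum]
    simp [h2, h.card_nbr x]
  rw [h3] at h1
  simp only [h2] at h1
  simp at h1
  have := h.k_eq
  nlinarith

/-- The quadratic form of a multiple of the projection onto the `-m`-eigenspace. -/
theorem eigenprojection_form (u : V → ℝ) :
    ((l : ℝ) - μ + 2 * m) * ((l - μ + m) * ∑ x, u x ^ 2 - ∑ x, u x * nbrSum G u x +
      μ / (k + m) * (∑ x, u x) ^ 2) =
    ∑ x, ((l - μ + m) * u x - nbrSum G u x + μ / (k + m) * ∑ y, u y) ^ 2 := by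
  have hkm : (0 : ℝ) < k + m := by
    have := h.k_pos
    positivity
  set S := ∑ x, u x with hS
  set c : ℝ := μ / (k + m) with hc
  have hcm : c * (k + m) = μ := by rw [hc]; field_simp
  -- With `E = θI - A + cJ`, this says that `E` annihilates constants. It also kills the
  -- `θ`-eigenspace and is `θ + m` on the `-m`-eigenspace, whence `(θ + m)E = E²`.
  have hcv : c * Fintype.card V = k - (l - μ + m) := by
    have := h.card_eq
    rw [hc]
    field_simp
    linarith
  have hw := sum_nbrSum h.card_nbr u
  have hww : ∑ x, nbrSum G u x ^ 2 = k * ∑ x, u x ^ 2 + l * ∑ x, u x * nbrSum G u x +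
      μ * (S ^ 2 - ∑ x, u x ^ 2 - ∑ x, u x * nbrSum G u x) := by
    have h1 := sum_mul_nbrSum (G := G) u (nbrSum G u)
    have h2 : ∑ x, nbrSum G u x ^ 2 = ∑ x, nbrSum G u x * nbrSum G u x :=
      sum_congr rfl fun x _ => sq _
    rw [h2, ← h1]
    have h3 : ∀ x, u x * nbrSum G (nbrSum G u) x = k * u x ^ 2 + l * (u x * nbrSum G u x) +
        μ * (S * u x - u x ^ 2 - u x * nbrSum G u x) := by
      intro x
      rw [nbrSum_nbrSum h.card_nbr h.card_adj h.card_not_adj u x]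
      ring
    simp only [h3, sum_add_distrib, ← mul_sum, sum_sub_distrib]
    rw [← hS]
    ring
  have hexp : ∀ x, ((l - μ + m) * u x - nbrSum G u x + c * S) ^ 2 =
      (l - μ + m) ^ 2 * u x ^ 2 + nbrSum G u x ^ 2 + c ^ 2 * S ^ 2 -
        2 * (l - μ + m) * (u x * nbrSum G u x) + 2 * (l - μ + m) * c * S * u x
        - 2 * c * S * nbrSum G u x := by
    intro x; ring
  simp only [hexp, sum_add_distrib, sum_sub_distrib, ← mul_sum, sum_const, card_univ,
    nsmul_eq_mul]
  rw [hww, hw, ← hS]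
  have hk := h.k_eq
  have e2 : (k : ℝ) - μ = m * (l - μ + m) := by linarith
  linear_combination (- ∑ x, u x ^ 2) * e2 + S ^ 2 * hcm - c * S ^ 2 * hcv

theorem form_nonneg (u : V → ℝ) :
    0 ≤ ((l : ℝ) - μ + m) * ∑ x, u x ^ 2 - ∑ x, u x * nbrSum G u x +
      μ / (k + m) * (∑ x, u x) ^ 2 := by
  have h1 := h.eigenprojection_form u
  have h2 : (0 : ℝ) < (l : ℝ) - μ + 2 * m := by
    have h2 : (μ : ℝ) ≤ l := by exact_mod_cast h.mu_le
    have h3 : (2 : ℝ) ≤ m := by exact_mod_cast h.two_le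
    linarith
  by_contra! hcon
  have := mul_neg_of_pos_of_neg h2 hcon
  rw [h1] at this
  exact absurd this (not_lt.2 (sum_nonneg fun x _ => sq_nonneg _))

/-- The sign is that of `k + m - m * c.card`, so the Delsarte bound follows from `form_nonneg`, and
equality makes the form vanish. -/
theorem form_of_clique (c : Finset V) (hc : ∀ y ∈ c, ∀ z ∈ c, y ≠ z → G.Adj y z) :
    (((l : ℝ) - μ + m) * ∑ x, (if x ∈ c then (1 : ℝ) else 0) ^ 2 -
      ∑ x, (if x ∈ c then (1 : ℝ) else 0) * nbrSum G (fun x => if x ∈ c then (1 : ℝ) else 0) x +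
      μ / (k + m) * (∑ x, (if x ∈ c then (1 : ℝ) else 0)) ^ 2) * (k + m) =
    c.card * ((l - μ + m) + 1) * (k + m - m * c.card) := by
  have hkm : (0 : ℝ) < k + m := by
    have := h.k_pos
    positivity
  have e1 : ∀ x, (if x ∈ c then (1 : ℝ) else 0) ^ 2 = if x ∈ c then (1 : ℝ) else 0 := by
    intro x; split_ifs <;> simp
  have e2 : ∑ x, (if x ∈ c then (1 : ℝ) else 0) = c.card := by simp
  have e3 : ∀ x, (if x ∈ c then (1 : ℝ) else 0) *
      nbrSum G (fun x => if x ∈ c then (1 : ℝ) else 0) x =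
      (if x ∈ c then ((c.card : ℝ) - 1) else 0) := by
    intro x
    by_cases hx : x ∈ c
    · have : G.neighborFinset x ∩ c = c.erase x := by
        ext y
        simp only [mem_inter, SimpleGraph.mem_neighborFinset, mem_erase]
        constructor
        · rintro ⟨h1, h2⟩
          exact ⟨fun h => G.loopless.irrefl x (h ▸ h1), h2⟩
        · rintro ⟨h1, h2⟩
          exact ⟨hc x hx y h2 h1.symm, h2⟩
      have h1 := card_erase_add_one hx
      have h2 : ((c.erase x).card : ℝ) = c.card - 1 := by rw [← h1]; push_cast; ring
      simp [hx, nbrSum, sum_ite_mem, this, -card_erase_of_mem, h2]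
    · simp [hx]
  simp only [e1, e2, e3]
  have e4 : ∑ x, (if x ∈ c then ((c.card : ℝ) - 1) else 0) = c.card * (c.card - 1) := by
    rw [sum_ite_mem, univ_inter, sum_const, nsmul_eq_mul]
  rw [e4]
  have hk := h.k_eq
  field_simp
  linear_combination (- (c.card : ℝ) ^ 2) * hk

/-- The Delsarte bound. -/
theorem clique_card_le (c : Finset V) (hc : ∀ y ∈ c, ∀ z ∈ c, y ≠ z → G.Adj y z) :
    m * c.card ≤ k + m := by
  have h1 := h.form_of_clique c hc
  have h2 := h.form_nonneg (fun x => if x ∈ c then (1 : ℝ) else 0)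
  have hkm : (0 : ℝ) < k + m := by
    have := h.k_pos
    positivity
  have h3 := mul_nonneg h2 hkm.le
  rw [h1] at h3
  by_contra! hcon
  have h4 : (k : ℝ) + m < m * c.card := by exact_mod_cast hcon
  have h5 : (0 : ℝ) < c.card := by
    rcases Nat.eq_zero_or_pos c.card with h0 | h0
    · rw [h0] at hcon; simp at hcon
    · exact_mod_cast h0
  have h6 : (0 : ℝ) < (l : ℝ) - μ + m + 1 := by
    have h2 : (μ : ℝ) ≤ l := by exact_mod_cast h.mu_le
    have : (0 : ℝ) ≤ m := by positivity
    linarith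
  have := mul_pos (mul_pos h5 h6) (sub_pos.2 h4)
  linarith

/-- A vertex outside a clique meeting the Delsarte bound has exactly `μ / m` neighbours in it. -/
theorem card_nbr_delsarte (c : Finset V) (hc : ∀ y ∈ c, ∀ z ∈ c, y ≠ z → G.Adj y z)
    (hcard : m * c.card = k + m) (y : V) (hy : y ∉ c) :
    m * (G.neighborFinset y ∩ c).card = μ := by
  have hkm : (0 : ℝ) < k + m := by
    have := h.k_pos
    positivity
  have hcard' : (m : ℝ) * c.card = k + m := by exact_mod_cast hcard
  have h1 := h.form_of_clique c hc
  rw [hcard', sub_self, mul_zero, mul_eq_zero, or_iff_left hkm.ne'] at h1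
  have h2 := h.eigenprojection_form (fun x => if x ∈ c then (1 : ℝ) else 0)
  -- The form is a sum of squares, so its vanishing kills every coordinate; the one at `y` contains
  -- the number of neighbours of `y` in `c`.
  rw [h1, mul_zero, eq_comm, sum_eq_zero_iff_of_nonneg (fun x _ => sq_nonneg _)] at h2
  have h3 := pow_eq_zero_iff (two_ne_zero) |>.1 (h2 y (mem_univ y))
  have e2 : ∑ x, (if x ∈ c then (1 : ℝ) else 0) = c.card := by simp
  rw [e2] at h3
  simp only [hy, if_false, nbrSum, sum_ite_mem, sum_const, nsmul_eq_mul, mul_one, mul_zero] at h3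
  have hm : (0 : ℝ) < m := by
    have := h.two_le
    exact_mod_cast (by omega : 0 < m)
  have h4 : (μ : ℝ) / (k + m) * c.card = μ / m := by
    rw [← hcard']
    have : (c.card : ℝ) ≠ 0 := by
      rintro h0
      rw [h0] at hcard'
      simp at hcard'
      linarith
    field_simp
  rw [h4] at h3
  have h5 : ((G.neighborFinset y ∩ c).card : ℝ) = μ / m := by linarith
  have h6 : (m : ℝ) * (G.neighborFinset y ∩ c).card = μ := by
    rw [h5]; field_simp
  exact_mod_cast h6

end SpectralData

/-! ### Incidence sums over a line system -/

namespace LineSystem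

variable {F : Finset (Finset V)} (hF : LineSystem G F)
include hF

/-- The lines on `x`, each with `x` removed, partition the neighbourhood of `x`. -/
theorem sum_neighborFinset {M : Type*} [AddCommMonoid M] (g : V → M) (x : V) :
    ∑ y ∈ G.neighborFinset x, g y = ∑ c ∈ F.filter (x ∈ ·), ∑ y ∈ c.erase x, g y := by
  rw [← sum_biUnion]
  · refine sum_congr ?_ fun _ _ => rfl
    ext y
    simp only [SimpleGraph.mem_neighborFinset, mem_biUnion, mem_filter, mem_erase]
    constructor
    · intro hxy
      obtain ⟨c, hc, hx, hy⟩ := hF.cover x y hxy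
      exact ⟨c, ⟨hc, hx⟩, hxy.ne', hy⟩
    · rintro ⟨c, ⟨hc, hx⟩, hne, hy⟩
      exact (hF.maxClique c hc).1 x hx y hy hne.symm
  · intro c hc d hd hcd
    rw [Function.onFun, disjoint_left]
    intro y hyc hyd
    rw [mem_coe, mem_filter] at hc hd
    rw [mem_erase] at hyc hyd
    exact hcd (hF.unique x y hyc.1.symm c hc.1 d hd.1 hc.2 hyc.2 hd.2 hyd.2)

theorem degree_eq {k : ℕ} (hk : ∀ x, (G.neighborFinset x).card = k) (x : V) :
    ∑ c ∈ F.filter (x ∈ ·), (c.card - 1) = k := by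
  have h1 := hF.sum_neighborFinset (fun _ => 1) x
  rw [← card_eq_sum_ones, hk x] at h1
  rw [h1]
  refine sum_congr rfl fun c hc => ?_
  rw [← card_eq_sum_ones, card_erase_of_mem (mem_filter.1 hc).2]

/-- The sum of squares of line sums. -/
theorem sum_sq_line (u : V → ℝ) :
    ∑ c ∈ F, (∑ x ∈ c, u x) ^ 2 =
      ∑ x, u x * nbrSum G u x + ∑ x, ((F.filter (x ∈ ·)).card : ℝ) * u x ^ 2 := by
  -- With `N` the vertex–line incidence matrix, the identity is `N Nᵀ = A + D`, where `D` is
  -- diagonal and counts the lines on a vertex.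
  have h1 : ∀ c ∈ F, (∑ x ∈ c, u x) ^ 2 =
      ∑ x, if x ∈ c then u x * ∑ y ∈ c, u y else 0 := by
    intro c _
    rw [sq, sum_mul, sum_ite_mem, univ_inter]
  rw [sum_congr rfl h1, sum_comm, ← sum_add_distrib]
  refine sum_congr rfl fun x _ => ?_
  rw [← sum_filter, ← mul_sum, nbrSum, hF.sum_neighborFinset]
  have h2 : ∀ c ∈ F.filter (x ∈ ·), ∑ y ∈ c, u y = ∑ y ∈ c.erase x, u y + u x := by
    intro c hc
    rw [sum_erase_add _ _ (mem_filter.1 hc).2]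
  rw [sum_congr rfl h2, sum_add_distrib, sum_const, nsmul_eq_mul]
  ring

end LineSystem

end SRGBound

/-! ### Every vertex is on exactly `m` lines -/

namespace SRGBound

open Finset

variable {V : Type*} [Fintype V] [DecidableEq V] {G : SimpleGraph V} [DecidableRel G.Adj]

namespace SpectralData

variable {k l μ m : ℕ} (h : SpectralData G k l μ m) {F : Finset (Finset V)}
  (hF : LineSystem G F)
include h hF

theorem mul_card_sub_one_le {c : Finset V} (hc : c ∈ F) : m * (c.card - 1) ≤ k := by
  have := h.clique_card_le c (hF.maxClique c hc).1
  rw [Nat.mul_sub_one]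
  omega

/-- By the Delsarte bound a line on `x` covers at most `k/m` of its `k` neighbours. -/
theorem le_card_lines (x : V) : m ≤ (F.filter (x ∈ ·)).card := by
  have h1 : m * k ≤ (F.filter (x ∈ ·)).card * k := by
    rw [← hF.degree_eq h.card_nbr x, mul_sum, hF.degree_eq h.card_nbr x, ← smul_eq_mul]
    exact sum_le_card_nsmul _ _ _ fun c hc => h.mul_card_sub_one_le hF (mem_filter.1 hc).1
  exact Nat.le_of_mul_le_mul_right h1 h.k_pos

/-- The equality case: `m` lines covering at most `k/m` neighbours each must all reach that maximum.
-/
theorem delsarte_of_card_lines_eq {x : V} (hx : (F.filter (x ∈ ·)).card = m) {c : Finset V}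
    (hc : c ∈ F) (hxc : x ∈ c) : m * c.card = k + m := by
  have h1 : ∑ c ∈ F.filter (x ∈ ·), m * (c.card - 1) = ∑ c ∈ F.filter (x ∈ ·), k := by
    rw [← mul_sum, hF.degree_eq h.card_nbr x, sum_const, hx, smul_eq_mul]
  have h2 := (sum_eq_sum_iff_of_le
    (fun c hc => h.mul_card_sub_one_le hF (mem_filter.1 hc).1)).1 h1 c (mem_filter.2 ⟨hc, hxc⟩)
  have h3 : 0 < c.card := card_pos.2 ⟨x, hxc⟩
  obtain ⟨n, hn⟩ : ∃ n, c.card = n + 1 := ⟨c.card - 1, by omega⟩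
  rw [hn] at h2 ⊢
  rw [← h2]
  simp
  ring

/-- The vertices on more than `m` lines are at most as many as the lines. -/
theorem card_irregular_le :
    (univ.filter fun x => (F.filter (x ∈ ·)).card ≠ m).card ≤ F.card := by
  by_contra! hcon
  set U := univ.filter fun x => (F.filter (x ∈ ·)).card ≠ m with hU
  -- More columns than rows: a nonzero vector on `U` has all line sums zero. Then `0 = uᵀ(A + D)u`,
  -- although `A + mI ≥ 0` and `D > m` on `U`.
  let M : Matrix F U ℝ := fun c x => if (x : V) ∈ (c : Finset V) then 1 else 0
  have hker : LinearMap.ker M.mulVecLin ≠ ⊥ := by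
    apply LinearMap.ker_ne_bot_of_finrank_lt
    simpa using hcon
  obtain ⟨w, hw, hw0⟩ := (Submodule.ne_bot_iff _).1 hker
  rw [LinearMap.mem_ker, Matrix.mulVecLin_apply] at hw
  let u : V → ℝ := fun x => if hx : x ∈ U then w ⟨x, hx⟩ else 0
  have hline : ∀ c ∈ F, ∑ x ∈ c, u x = 0 := by
    intro c hc
    have h1 := congrFun hw ⟨c, hc⟩
    simp only [Matrix.mulVec, dotProduct, M, Pi.zero_apply, ite_mul, one_mul, zero_mul] at h1
    rw [← h1, ← univ_inter c, ← sum_ite_mem, ← sum_subset (subset_univ U), ← sum_coe_sort U]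
    · refine sum_congr rfl fun x _ => ?_
      simp [u]
    · intro x _ hx
      simp [u, hx]
  have h1 := hF.sum_sq_line u
  rw [sum_eq_zero (fun c hc => by rw [hline c hc]; ring)] at h1
  have h2 := h.psd u
  have h3 : ∑ x, ((F.filter (x ∈ ·)).card : ℝ) * u x ^ 2 ≤ m * ∑ x, u x ^ 2 := by linarith
  obtain ⟨x, hx⟩ := Function.ne_iff.1 hw0
  have h4 : (m : ℝ) * ∑ x, u x ^ 2 < ∑ x, ((F.filter (x ∈ ·)).card : ℝ) * u x ^ 2 := by
    rw [mul_sum]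
    apply sum_lt_sum
    · intro y _
      have := h.le_card_lines hF y
      gcongr
    · refine ⟨x, mem_univ _, ?_⟩
      have hux : u x = w x := by simp [u]
      have h5 := h.le_card_lines hF (x : V)
      have h6 : (F.filter ((x : V) ∈ ·)).card ≠ m := (mem_filter.1 x.2).2
      have h7 : (m : ℝ) < (F.filter ((x : V) ∈ ·)).card := by
        exact_mod_cast lt_of_le_of_ne h5 h6.symm
      have h8 : 0 < u x ^ 2 := by
        rw [hux]
        have : w x ≠ 0 := hx
        positivity
      exact mul_lt_mul_of_pos_right h7 h8
  linarith

theorem mul_card_lines_le {s t : ℕ} (hs : ∀ x, (F.filter (x ∈ ·)).card ≤ s)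
    (hbig : ∀ c ∈ F, t * s ≤ c.card) : t * F.card ≤ Fintype.card V := by
  obtain ⟨x⟩ := h.nonempty
  have hs0 : 0 < s := by
    have := (h.le_card_lines hF x).trans (hs x)
    have := h.two_le
    omega
  have h1 : F.card * (t * s) ≤ ∑ c ∈ F, c.card := by
    rw [← smul_eq_mul]
    exact card_nsmul_le_sum _ _ _ hbig
  have h2 : ∑ c ∈ F, c.card = ∑ x, (F.filter (x ∈ ·)).card := by
    simp only [card_filter]
    rw [sum_comm]
    exact sum_congr rfl fun c _ => by simp
  have h3 : ∑ x, (F.filter (x ∈ ·)).card ≤ Fintype.card V * s := by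
    rw [← smul_eq_mul, ← card_univ]
    exact sum_le_card_nsmul _ _ _ fun x _ => hs x
  have h4 : (t * F.card) * s ≤ Fintype.card V * s := by
    calc (t * F.card) * s = F.card * (t * s) := by ring
      _ ≤ _ := by omega
  exact Nat.le_of_mul_le_mul_right h4 hs0

/-- Otherwise all vertices are irregular, so there are at least as many lines as vertices, while
long lines allow at most half as many. -/
theorem exists_card_lines_eq {s : ℕ} (hs : ∀ x, (F.filter (x ∈ ·)).card ≤ s)
    (hbig : ∀ c ∈ F, 2 * s ≤ c.card) : ∃ z, (F.filter (z ∈ ·)).card = m := by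
  have hU := h.card_irregular_le hF
  have hle := h.mul_card_lines_le hF hs hbig
  have hV : 0 < Fintype.card V := Fintype.card_pos_iff.2 h.nonempty
  by_contra! hall
  rw [filter_true_of_mem (fun x _ => hall x), card_univ] at hU
  omega

/-- If the lines are large compared to their number on a vertex, then `m` divides `μ`. -/
theorem dvd_mu {s : ℕ} (hs : ∀ x, (F.filter (x ∈ ·)).card ≤ s)
    (hbig : ∀ c ∈ F, 2 * s ≤ c.card) (hne : ∀ c ∈ F, ∃ y, y ∉ c) : m ∣ μ := by
  obtain ⟨z, hz⟩ := h.exists_card_lines_eq hF hs hbig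
  have hm := h.two_le
  obtain ⟨c, hc⟩ : (F.filter (z ∈ ·)).Nonempty := card_pos.1 (by omega)
  rw [mem_filter] at hc
  obtain ⟨y, hy⟩ := hne c hc.1
  exact ⟨_, (h.card_nbr_delsarte c (hF.maxClique c hc.1).1
    (h.delsarte_of_card_lines_eq hF hz hc.1 hc.2) y hy).symm⟩

/-- A vertex on more than `m` lines is on at most `m - 2` lines meeting the Delsarte bound. -/
theorem card_delsarte_lines_le (h2 : ∀ c ∈ F, 2 ≤ c.card) {κ : ℕ} (hκ : m * κ = k) {p : V}
    (hp : (F.filter (p ∈ ·)).card ≠ m) :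
    ((F.filter (p ∈ ·)).filter fun c => m * c.card = k + m).card + 2 ≤ m := by
  have hm := h.two_le
  have hD : m < (F.filter (p ∈ ·)).card :=
    lt_of_le_of_ne (h.le_card_lines hF p) hp.symm
  set Fp := F.filter (p ∈ ·) with hFp
  have hdel : ∀ c : Finset V, m * c.card = k + m ↔ c.card = κ + 1 := by
    intro c
    rw [← hκ, ← Nat.mul_succ]
    constructor
    · exact fun h => Nat.eq_of_mul_eq_mul_left (by omega) h
    · rintro h; rw [h]
  simp only [hdel]
  set Dp := Fp.filter fun c => c.card = κ + 1 with hDp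
  set Np := Fp.filter fun c => ¬ c.card = κ + 1 with hNp
  have hcards : Dp.card + Np.card = Fp.card :=
    card_filter_add_card_filter_not _
  have hsum : Dp.card * κ + ∑ c ∈ Np, (c.card - 1) = m * κ := by
    rw [hκ, ← hF.degree_eq h.card_nbr p, ← hFp,
      ← sum_filter_add_sum_filter_not Fp (fun c => c.card = κ + 1), ← hDp, ← hNp]
    congr 1
    rw [sum_congr rfl (g := fun _ => κ) (fun c hc => by rw [(mem_filter.1 hc).2]; rfl), sum_const,
      smul_eq_mul]
  have hκ0 : 0 < κ := by
    rcases Nat.eq_zero_or_pos κ with h0 | h0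
    · have := h.k_pos
      rw [← hκ, h0] at this
      simp at this
    · exact h0
  have hNp2 : ∀ c ∈ Np, 2 ≤ c.card := fun c hc => h2 c (mem_filter.1 (mem_filter.1 hc).1).1
  -- Valency counting now leaves exactly `m - 1` Delsarte lines on `p` and at least two shorter
  -- ones, which together contain `κ` neighbours of `p`. The contradiction comes from counting the
  -- common neighbours of `p` and a point `q` of the short line `c₁`.
  by_contra! hcon
  have hle : Dp.card ≤ m :=
    Nat.le_of_mul_le_mul_right (show Dp.card * κ ≤ m * κ by omega) hκ0
  have hne : Np.card ≠ 0 := by omega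
  obtain ⟨c₀, hc₀⟩ := card_ne_zero.1 hne
  have hpos : 0 < ∑ c ∈ Np, (c.card - 1) :=
    sum_pos (fun c hc => by have := hNp2 c hc; omega) ⟨c₀, hc₀⟩
  have ha : Dp.card = m - 1 := by
    rcases Nat.lt_or_ge Dp.card m with h0 | h0
    · omega
    · have := Nat.mul_le_mul_right κ h0
      omega
  have hsumN : ∑ c ∈ Np, (c.card - 1) = κ := by
    have h1 : m * κ = (m - 1) * κ + κ := by
      conv_lhs => rw [show m = (m - 1) + 1 by omega]
      ring
    rw [ha] at hsum
    omega
  obtain ⟨c₁, hc₁, c₂, hc₂, h12⟩ := one_lt_card.1 (show 1 < Np.card by omega)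
  have memN : ∀ c ∈ Np, c ∈ F ∧ p ∈ c := fun c hc => mem_filter.1 (mem_filter.1 hc).1
  have memD : ∀ c ∈ Dp, c ∈ F ∧ p ∈ c := fun c hc => mem_filter.1 (mem_filter.1 hc).1
  obtain ⟨q, hq, hqp⟩ := exists_mem_ne (hNp2 c₁ hc₁) p
  have hpq : G.Adj p q := (hF.maxClique c₁ (memN c₁ hc₁).1).1 p (memN c₁ hc₁).2 q hq hqp.symm
  have hqc : ∀ c ∈ Fp, c ≠ c₁ → q ∉ c := by
    intro c hc hcc hqc
    rw [mem_filter] at hc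
    exact hcc (hF.unique p q hqp.symm c hc.1 c₁ (memN c₁ hc₁).1 hc.2 hqc (memN c₁ hc₁).2 hq)
  obtain ⟨w, hw, hqw⟩ := (hF.maxClique c₂ (memN c₂ hc₂).1).2 q
    (hqc c₂ (mem_filter.1 hc₂).1 h12.symm)
  have hwp : w ≠ p := by rintro rfl; exact hqw hpq.symm
  obtain ⟨C, hC⟩ : Dp.Nonempty := card_pos.1 (by omega)
  have hCne : ∀ C ∈ Dp, C ≠ c₁ := by
    rintro C hC rfl
    exact (mem_filter.1 hc₁).2 (mem_filter.1 hC).2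
  have hcount : ∀ C ∈ Dp, m * (G.neighborFinset q ∩ C).card = μ := by
    intro C hC
    exact h.card_nbr_delsarte C (hF.maxClique C (memD C hC).1).1
      ((hdel C).2 (mem_filter.1 hC).2) q (hqc C (mem_filter.1 hC).1 (hCne C hC))
  obtain ⟨e, he⟩ : ∃ e, (G.neighborFinset q ∩ C).card = e := ⟨_, rfl⟩
  have heμ : m * e = μ := he ▸ hcount C hC
  have hcount' : ∀ C ∈ Dp, (G.neighborFinset q ∩ C).card = e := fun C hC =>
    Nat.eq_of_mul_eq_mul_left (show 0 < m by omega) ((hcount C hC).trans heμ.symm)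
  have hpN : p ∈ G.neighborFinset q := by simpa using hpq.symm
  let g : Finset V → ℤ := fun c => ∑ y ∈ c.erase p, if G.Adj q y then 1 else 0
  have hg : ∀ c, g c = ((c.erase p).filter (G.Adj q)).card := by
    intro c
    simp [g]
  have htot : ∑ c ∈ Fp, g c = l := by
    rw [← hF.sum_neighborFinset (fun y => if G.Adj q y then (1 : ℤ) else 0) p,
      ← h.card_adj p q hpq]
    rw [sum_boole]
    congr 2
    ext y
    simp
  have hle1 : ∀ c ∈ Np, g c ≤ c.card - 1 := by
    intro c hc
    rw [hg]
    have h1 := card_filter_le (c.erase p) (G.Adj q)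
    have h3 := card_erase_add_one (memN c hc).2
    push_cast [← h3]
    omega
  have hle2 : ∀ c ∈ Np, (∃ y ∈ c, y ≠ p ∧ ¬ G.Adj q y) → g c + 1 ≤ c.card - 1 := by
    rintro c hc ⟨y, hy, hyp, hqy⟩
    rw [hg]
    have h1 : ((c.erase p).filter (G.Adj q)).card < (c.erase p).card :=
      card_lt_card ((filter_ssubset).2 ⟨y, mem_erase.2 ⟨hyp, hy⟩, hqy⟩)
    have h3 := card_erase_add_one (memN c hc).2
    push_cast [← h3]
    omega
  have hle3 : ∀ c ∈ Dp, g c = e - 1 := by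
    intro c hc
    rw [hg, ← hcount' c hc]
    have h1 : (c.erase p).filter (G.Adj q) = (G.neighborFinset q ∩ c).erase p := by
      ext y
      simp
      tauto
    have h3 := card_erase_add_one (mem_inter.2 ⟨hpN, (memD c hc).2⟩)
    rw [h1, ← h3]
    push_cast
    ring
  have hD : ∑ c ∈ Dp, g c = (m - 1) * (e - 1) := by
    rw [sum_congr rfl hle3, sum_const, ha, nsmul_eq_mul, Nat.cast_sub (by omega)]
    simp
  -- Two of the `κ` neighbours on short lines are lost: `q` itself on `c₁`, and a vertex `w` of `c₂`
  -- not adjacent to `q`. This gives `l ≤ l - 1` in the end.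
  have hN : ∑ c ∈ Np, g c + 2 ≤ κ := by
    have h1 : ∑ c ∈ Np, (g c + ((if c = c₁ then 1 else 0) + (if c = c₂ then 1 else 0))) ≤
        ∑ c ∈ Np, ((c.card : ℤ) - 1) := by
      apply sum_le_sum
      intro c hc
      by_cases hc1 : c = c₁
      · subst hc1
        simpa [h12] using hle2 c hc ⟨q, hq, hqp, G.loopless.irrefl q⟩
      · by_cases hc2 : c = c₂
        · subst hc2
          simpa [hc1] using hle2 c hc ⟨w, hw, hwp, hqw⟩
        · simpa [hc1, hc2] using hle1 c hc
    rw [sum_add_distrib, sum_add_distrib, sum_ite_eq', sum_ite_eq', if_pos hc₁, if_pos hc₂] at h1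
    have h3 : ∑ c ∈ Np, ((c.card : ℤ) - 1) = κ := by
      rw [← hsumN]
      push_cast
      refine sum_congr rfl fun c hc => ?_
      have := hNp2 c hc
      rw [Nat.cast_sub (by omega)]
      simp
    rw [h3] at h1
    linarith
  have hsplit : ∑ c ∈ Dp, g c + ∑ c ∈ Np, g c = ∑ c ∈ Fp, g c :=
    sum_filter_add_sum_filter_not _ _ _
  have hkeq : (k : ℤ) = μ + m * (l - μ + m) := by exact_mod_cast h.k_eq
  rw [← hκ, ← heμ] at hkeq
  push_cast at hkeq
  have hm' : (m : ℤ) ≠ 0 := by omega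
  have hkeq' : (κ : ℤ) = e + (l - m * e + m) := by
    apply mul_left_cancel₀ hm'
    linarith
  rw [htot, hD] at hsplit
  nlinarith

/-- Under the size condition, every vertex is on exactly `m` lines. -/
theorem card_lines_eq {s : ℕ} (hs : ∀ x, (F.filter (x ∈ ·)).card ≤ s)
    (hbig : ∀ c ∈ F, m * s ≤ c.card) (x : V) : (F.filter (x ∈ ·)).card = m := by
  have hm := h.two_le
  have hm0 : (0 : ℝ) < m := by exact_mod_cast (by omega : 0 < m)
  have hle := h.mul_card_lines_le hF hs hbig
  have hU := h.card_irregular_le hF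
  set U := univ.filter fun x => (F.filter (x ∈ ·)).card ≠ m with hUdef
  have hmU : m * U.card ≤ Fintype.card V := (Nat.mul_le_mul_left m hU).trans hle
  have h2 : ∀ c ∈ F, 2 ≤ c.card := by
    intro c hc
    have h1 := hbig c hc
    have h3 := (h.le_card_lines hF x).trans (hs x)
    nlinarith
  obtain ⟨z, hz'⟩ := h.exists_card_lines_eq hF hs fun c hc =>
    (Nat.mul_le_mul_right s hm).trans (hbig c hc)
  obtain ⟨c₀, hc₀⟩ : (F.filter (z ∈ ·)).Nonempty := card_pos.1 (by omega)
  rw [mem_filter] at hc₀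
  have hK := h.delsarte_of_card_lines_eq hF hz' hc₀.1 hc₀.2
  have hc₀pos := h2 c₀ hc₀.1
  obtain ⟨κ, hκ'⟩ : ∃ κ, c₀.card = κ + 1 := ⟨c₀.card - 1, by omega⟩
  have hκ : m * κ = k := by
    rw [hκ', Nat.mul_succ] at hK
    omega
  by_contra hx
  have hxU : x ∈ U := by simpa [hUdef] using hx
  -- At least `2κ` neighbours of `p` lie on non-Delsarte lines, and every point of such a line is in
  -- `U`, since points on `m` lines are only on Delsarte lines.
  have hdeg : ∀ p ∈ U, 2 * (κ : ℝ) ≤ nbrSum G (fun y => if y ∈ U then (1 : ℝ) else 0) p := by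
    intro p hp
    have hp' : (F.filter (p ∈ ·)).card ≠ m := (mem_filter.1 hp).2
    have ha := h.card_delsarte_lines_le hF h2 hκ hp'
    rw [nbrSum, hF.sum_neighborFinset,
      ← sum_filter_add_sum_filter_not _ (fun c => m * c.card = k + m)]
    set Fp := F.filter (p ∈ ·) with hFp
    set Dp := Fp.filter fun c => m * c.card = k + m with hDp
    set Np := Fp.filter fun c => ¬ m * c.card = k + m with hNp
    have hsum : ∑ c ∈ Dp, (c.card - 1) + ∑ c ∈ Np, (c.card - 1) = k := by
      rw [sum_filter_add_sum_filter_not]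
      exact hF.degree_eq h.card_nbr p
    have hD : ∑ c ∈ Dp, (c.card - 1) = Dp.card * κ := by
      rw [sum_congr rfl (g := fun _ => κ), sum_const, smul_eq_mul]
      intro c hc
      have h1 := (mem_filter.1 hc).2
      have h3 : m * c.card = m * (κ + 1) := by rw [h1, ← hκ]; ring
      rw [Nat.eq_of_mul_eq_mul_left (by omega) h3]
      rfl
    have hN : ∑ c ∈ Np, ∑ y ∈ c.erase p, (if y ∈ U then (1 : ℝ) else 0) =
        ((∑ c ∈ Np, (c.card - 1) : ℕ) : ℝ) := by
      rw [Nat.cast_sum]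
      refine sum_congr rfl fun c hc => ?_
      have hc1 := mem_filter.1 (mem_filter.1 hc).1
      rw [sum_congr rfl (g := fun _ => (1 : ℝ)), sum_const, nsmul_eq_mul, mul_one,
        card_erase_of_mem hc1.2]
      intro y hy
      rw [if_pos]
      by_contra hyU
      have hy' : (F.filter (y ∈ ·)).card = m := by simpa [hUdef] using hyU
      exact (mem_filter.1 hc).2
        (h.delsarte_of_card_lines_eq hF hy' hc1.1 (mem_of_mem_erase hy))
    have hnn : 0 ≤ ∑ c ∈ Dp, ∑ y ∈ c.erase p, (if y ∈ U then (1 : ℝ) else 0) :=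
      sum_nonneg fun c _ => sum_nonneg fun y _ => by split_ifs <;> norm_num
    have h3 : 2 * κ ≤ ∑ c ∈ Np, (c.card - 1) := by
      have h4 := Nat.mul_le_mul_right κ ha
      rw [Nat.add_mul, hκ] at h4
      omega
    have h3' : (2 : ℝ) * κ ≤ ((∑ c ∈ Np, (c.card - 1) : ℕ) : ℝ) := by exact_mod_cast h3
    linarith
  have hform := h.form_nonneg (fun y => if y ∈ U then (1 : ℝ) else 0)
  have e1 : ∑ y, (if y ∈ U then (1 : ℝ) else 0) ^ 2 = U.card := by simp
  have e2 : ∑ y, (if y ∈ U then (1 : ℝ) else 0) = U.card := by simp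
  have e3 : U.card * (2 * (κ : ℝ)) ≤ ∑ y, (if y ∈ U then (1 : ℝ) else 0) *
      nbrSum G (fun y => if y ∈ U then (1 : ℝ) else 0) y := by
    simp only [ite_mul, one_mul, zero_mul]
    rw [sum_ite_mem, univ_inter, ← nsmul_eq_mul]
    exact card_nsmul_le_sum _ _ _ hdeg
  rw [e1, e2] at hform
  have hUpos : (0 : ℝ) < U.card := by exact_mod_cast card_pos.2 ⟨x, hxU⟩
  have hkpos : (0 : ℝ) < k := by exact_mod_cast h.k_pos
  have hkm : (0 : ℝ) < k + m := by positivity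
  -- The average degree inside `U` is at most `θ + μ |U| / (k + m)`. With `m |U| ≤ v` this becomes
  -- `k ≤ (m - 1)θ`, contrary to `k = μ + mθ`.
  have h5 : 2 * (κ : ℝ) ≤ (l - μ + m) + μ / (k + m) * U.card := by
    have : 0 ≤ U.card * (((l : ℝ) - μ + m) + μ / (k + m) * U.card - 2 * κ) := by nlinarith
    have := nonneg_of_mul_nonneg_right this hUpos
    linarith
  have h6 : (m : ℝ) * (μ / (k + m) * U.card) ≤ k - (l - μ + m) := by
    have h7 : (m : ℝ) * U.card ≤ Fintype.card V := by exact_mod_cast hmU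
    have h8 := h.card_eq
    have h9 : (0 : ℝ) ≤ μ := by positivity
    have h10 : (m : ℝ) * (μ / (k + m) * U.card) = μ * (m * U.card) / (k + m) := by ring
    rw [h10, div_le_iff₀ hkm]
    nlinarith
  have hκr : (m : ℝ) * κ = k := by exact_mod_cast hκ
  have h11 := h.k_eq
  have h12 : (0 : ℝ) < μ := by exact_mod_cast h.mu_pos
  have h13 : (μ : ℝ) ≤ l := by exact_mod_cast h.mu_le
  nlinarith

end SpectralData

end SRGBound

/-! ### Krein condition and absolute bound for the lines of a partial geometry -/

namespace SRGBound

open Finset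

section Gram

variable {α ι κ : Type*} [Fintype α] [Fintype ι] [Fintype κ]

theorem sum_gram_nonneg (f : α → ι → ℝ) : 0 ≤ ∑ x, ∑ y, ∑ i, f x i * f y i := by
  have h1 : ∑ x, ∑ y, ∑ i, f x i * f y i = ∑ i, (∑ x, f x i) ^ 2 := by
    have h2 : ∀ x, ∑ y, ∑ i, f x i * f y i = ∑ i, f x i * ∑ y, f y i := by
      intro x
      rw [sum_comm]
      exact sum_congr rfl fun i _ => (mul_sum _ _ _).symm
    simp only [h2]
    rw [sum_comm]
    exact sum_congr rfl fun i _ => by rw [sq, sum_mul]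
  rw [h1]
  exact sum_nonneg fun i _ => sq_nonneg _

-- The entrywise product of two Gram matrices is the Gram matrix of the tensor products.
omit [Fintype α] in
theorem gram_mul_gram (f : α → ι → ℝ) (g : α → κ → ℝ) (x y : α) :
    (∑ i, f x i * f y i) * (∑ j, g x j * g y j) =
      ∑ p : ι × κ, (f x p.1 * g x p.2) * (f y p.1 * g y p.2) := by
  rw [sum_mul_sum, ← univ_product_univ, sum_product]
  exact sum_congr rfl fun i _ => sum_congr rfl fun j _ => by ring

/-- The entries of the Hadamard cube of a Gram matrix have a non-negative sum. -/
theorem sum_gram_cube_nonneg (f : α → ι → ℝ) : 0 ≤ ∑ x, ∑ y, (∑ i, f x i * f y i) ^ 3 := by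
  have h1 : ∀ x y, (∑ i, f x i * f y i) ^ 3 =
      ∑ p : (ι × ι) × ι, (f x p.1.1 * f x p.1.2 * f x p.2) * (f y p.1.1 * f y p.1.2 * f y p.2) := by
    intro x y
    rw [pow_succ, sq, gram_mul_gram]
    exact gram_mul_gram (fun x (p : ι × ι) => f x p.1 * f x p.2) f x y
  simp only [h1]
  exact sum_gram_nonneg fun x (p : (ι × ι) × ι) => f x p.1.1 * f x p.1.2 * f x p.2

end Gram

/-- The counting axioms of a finite partial geometry with `K` points on a line, `R` lines on a
point and `T` lines on a point meeting a line that does not contain it. -/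
structure FinitePG {P L : Type*} [Fintype P] [Fintype L] [DecidableEq P] [DecidableEq L]
    (I : P → L → Prop) [∀ p a, Decidable (I p a)] (K R T : ℕ) : Prop where
  line_unique : ∀ p q : P, p ≠ q → ∀ a b : L, I p a → I q a → I p b → I q b → a = b
  order_line : ∀ a : L, (univ.filter fun p => I p a).card = K
  order_point : ∀ p : P, (univ.filter fun a => I p a).card = R
  meeting : ∀ (a : L) (p : P), ¬ I p a →
    (univ.filter fun b : L => I p b ∧ ∃ q : P, I q b ∧ I q a).card = T
  nonempty_lines : Nonempty L
  one_lt_K : 1 < K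
  T_pos : 0 < T
  one_lt_R : 1 < R
  T_le : T ≤ R

namespace FinitePG

variable {P L : Type*} [Fintype P] [Fintype L] [DecidableEq P] [DecidableEq L]
  {I : P → L → Prop} [∀ p a, Decidable (I p a)] {K R T : ℕ}

/-- The multiple of the projection onto the functions on lines with zero sum around each point. -/
def proj (I : P → L → Prop) [∀ p a, Decidable (I p a)] (R T : ℕ) (a b : L) : ℝ :=
  if a = b then ((R : ℝ) - 1) * (R - T) else if ∃ p, I p a ∧ I p b then -((R : ℝ) - T) else T

/-- The sum of `s` over the lines that meet `a` in exactly one point. -/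
def meetSum (I : P → L → Prop) [∀ p a, Decidable (I p a)] (s : L → ℝ) (a : L) : ℝ :=
  ∑ b, if a ≠ b ∧ ∃ p, I p a ∧ I p b then s b else 0

omit [Fintype L] [DecidableEq P] in
theorem proj_symm (a b : L) : proj I R T a b = proj I R T b a := by
  have h1 : (∃ p, I p a ∧ I p b) ↔ ∃ p, I p b ∧ I p a := by simp only [and_comm]
  simp only [proj, h1, eq_comm (a := a) (b := b)]

-- `proj` takes three values, so every entrywise function of it is a combination of `I`, the meeting
-- relation and `J`. It is used for the first, second and third powers.
omit [DecidableEq P] in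
theorem sum_apply_proj (φ : ℝ → ℝ) (s : L → ℝ) (a : L) :
    ∑ b, φ (proj I R T a b) * s b =
      (φ (((R : ℝ) - 1) * (R - T)) - φ T) * s a + (φ (-((R : ℝ) - T)) - φ T) * meetSum I s a +
        φ T * ∑ b, s b := by
  have h1 : ∀ b, φ (proj I R T a b) * s b =
      (if a = b then (φ (((R : ℝ) - 1) * (R - T)) - φ T) * s a else 0) +
      (φ (-((R : ℝ) - T)) - φ T) * (if a ≠ b ∧ ∃ p, I p a ∧ I p b then s b else 0) +
      φ T * s b := by
    intro b
    by_cases hab : a = b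
    · subst hab
      simp [proj]
      ring
    · by_cases hm : ∃ p, I p a ∧ I p b
      · simp [proj, hab, hm]
        ring
      · simp only [proj, hab, hm, if_false, and_false, mul_zero, zero_add]
  simp only [h1, sum_add_distrib, ← mul_sum, sum_ite_eq, mem_univ, if_true, meetSum]

variable (h : FinitePG I K R T)
include h

theorem sum_point_line (s : L → ℝ) (a : L) :
    ∑ p ∈ univ.filter (I · a), ∑ b ∈ univ.filter (I p ·), s b = K * s a + meetSum I s a := by
  have h1 : ∀ p, ∑ b ∈ univ.filter (I p ·), s b = ∑ b, if I p b then s b else 0 := by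
    intro p; rw [sum_filter]
  simp only [h1]
  rw [sum_comm, meetSum]
  have h2 : ∀ b, ∑ p ∈ univ.filter (I · a), (if I p b then s b else 0) =
      (if a = b then K * s a else 0) + if a ≠ b ∧ ∃ p, I p a ∧ I p b then s b else 0 := by
    intro b
    rw [← sum_filter, sum_const, nsmul_eq_mul, filter_filter]
    by_cases hab : a = b
    · subst hab
      simp [h.order_line a]
    · by_cases hm : ∃ p, I p a ∧ I p b
      · obtain ⟨p, hpa, hpb⟩ := hm
        have : (univ.filter fun p => I p a ∧ I p b) = {p} := by
          ext q
          simp only [mem_filter, mem_univ, true_and, mem_singleton]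
          constructor
          · rintro ⟨hqa, hqb⟩
            by_contra hqp
            exact hab (h.line_unique q p hqp a b hqa hpa hqb hpb)
          · rintro rfl
            exact ⟨hpa, hpb⟩
        rw [this, card_singleton, if_neg hab, if_pos ⟨hab, p, hpa, hpb⟩]
        simp
      · have : (univ.filter fun p => I p a ∧ I p b) = ∅ := by
          ext q
          simp only [mem_filter, mem_univ, true_and, notMem_empty, iff_false]
          exact fun hq => hm ⟨q, hq⟩
        rw [this, if_neg hab, if_neg (fun h => hm h.2)]
        simp
  simp only [h2, sum_add_distrib, sum_ite_eq, mem_univ, if_true]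

theorem sum_eq_zero_of_point_sums (s : L → ℝ) (hs : ∀ p, ∑ b ∈ univ.filter (I p ·), s b = 0) :
    ∑ b, s b = 0 := by
  have h1 : ∑ p, ∑ b ∈ univ.filter (I p ·), s b = K * ∑ b, s b := by
    simp only [sum_filter]
    rw [sum_comm, mul_sum]
    refine sum_congr rfl fun b _ => ?_
    rw [← sum_filter, sum_const, h.order_line b, nsmul_eq_mul]
  simp only [hs, sum_const_zero] at h1
  have hK : (K : ℝ) ≠ 0 := by
    have := h.one_lt_K
    exact_mod_cast (by omega : K ≠ 0)
  exact (mul_eq_zero.1 h1.symm).resolve_left hK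

/-- By `sum_point_line`, zero point sums make `s` an eigenvector of the meeting relation with
eigenvalue `-K`. -/
theorem proj_mul_of_point_sums (s : L → ℝ) (hs : ∀ p, ∑ b ∈ univ.filter (I p ·), s b = 0)
    (a : L) : ∑ b, proj I R T a b * s b = R * (K + R - 1 - T) * s a := by
  have h1 := sum_apply_proj (I := I) (R := R) (T := T) id s a
  have h2 := h.sum_point_line s a
  simp only [hs, sum_const_zero] at h2
  simp only [id] at h1
  rw [h1, h.sum_eq_zero_of_point_sums s hs, show meetSum I s a = -(K * s a) by linarith]
  ring

/-- The three values of `proj` are chosen for this: off `x`, exactly `T` of the `R` lines on `p`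
meet `x`. -/
theorem point_sums_proj (x : L) (p : P) :
    ∑ b ∈ univ.filter (I p ·), proj I R T x b = 0 := by
  by_cases hp : I p x
  · have h1 : ∀ b ∈ univ.filter (I p ·), proj I R T x b =
        (if x = b then (R : ℝ) * (R - T) else 0) + -((R : ℝ) - T) := by
      intro b hb
      have hb' := (mem_filter.1 hb).2
      by_cases hxb : x = b
      · simp [proj, hxb]; ring
      · rw [proj, if_neg hxb, if_pos ⟨p, hp, hb'⟩, if_neg hxb, zero_add]
    rw [sum_congr rfl h1, sum_add_distrib, sum_ite_eq, if_pos (by simpa using hp), sum_const,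
      h.order_point p, nsmul_eq_mul]
    ring
  · have h1 : ∀ b ∈ univ.filter (I p ·), proj I R T x b =
        (if ∃ q, I q b ∧ I q x then -(R : ℝ) else 0) + T := by
      intro b hb
      have hb' := (mem_filter.1 hb).2
      have hxb : x ≠ b := by rintro rfl; exact hp hb'
      have h2 : (∃ q, I q x ∧ I q b) ↔ ∃ q, I q b ∧ I q x := by simp only [and_comm]
      by_cases hm : ∃ q, I q b ∧ I q x
      · rw [proj, if_neg hxb, if_pos (h2.2 hm), if_pos hm]; ring
      · rw [proj, if_neg hxb, if_neg (fun h => hm (h2.1 h)), if_neg hm]; ring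
    rw [sum_congr rfl h1, sum_add_distrib, ← sum_filter, filter_filter, sum_const, sum_const,
      h.meeting x p hp, h.order_point p, nsmul_eq_mul, nsmul_eq_mul]
    ring

/-- The rows of `proj` lie in the space on which it acts as a scalar. So `proj` is, up to a positive
factor, a Gram matrix. -/
theorem proj_mul_proj (a b : L) :
    ∑ c, proj I R T a c * proj I R T b c = R * (K + R - 1 - T) * proj I R T a b := by
  rw [h.proj_mul_of_point_sums (proj I R T b) (h.point_sums_proj b) a, proj_symm b a]

theorem scale_pos : (0 : ℝ) < R * (K + R - 1 - T) := by
  have h1 : (1 : ℝ) < K := by exact_mod_cast h.one_lt_K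
  have h2 : (T : ℝ) ≤ R := by exact_mod_cast h.T_le
  have h3 : (0 : ℝ) < T := by exact_mod_cast h.T_pos
  apply mul_pos <;> linarith

theorem meetSum_one (a : L) : meetSum I (fun _ => 1) a = K * (R - 1) := by
  have h1 := h.sum_point_line (fun _ => 1) a
  simp only [sum_const, h.order_point, h.order_line a, nsmul_eq_mul] at h1
  linarith

theorem card_lines_mul : (Fintype.card L : ℝ) * T = R * T + R * (K - 1) * (R - 1) := by
  obtain ⟨a⟩ := h.nonempty_lines
  have h1 := sum_apply_proj (I := I) (R := R) (T := T) id (fun _ => 1) a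
  simp only [id, mul_one] at h1
  rw [h.sum_eq_zero_of_point_sums _ (h.point_sums_proj a), h.meetSum_one] at h1
  simp only [sum_const, nsmul_eq_mul, card_univ] at h1
  linarith

/-- The Krein inequality for the lines of a partial geometry. -/
theorem krein (hTR : T < R) : 0 ≤ ((R : ℝ) - T) ^ 2 * ((R - 1) ^ 2 - K) + (K - 1) * T ^ 2 := by
  have h1 := sum_gram_cube_nonneg (proj I R T)
  have hs := h.scale_pos
  simp only [h.proj_mul_proj] at h1
  -- Every row has the same sum of cubes; `card_lines_mul` eliminates the number of lines and
  -- exposes the Krein expression.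
  have h2 : ∀ a : L, ∑ b, (R * (K + R - 1 - T) * proj I R T a b) ^ 3 =
      (R * (K + R - 1 - T)) ^ 3 * ((R - 1) * (R - T) *
        (((R : ℝ) - T) ^ 2 * ((R - 1) ^ 2 - K) + (K - 1) * T ^ 2)) := by
    intro a
    have h3 := sum_apply_proj (I := I) (R := R) (T := T) (fun x => x ^ 3) (fun _ => 1) a
    simp only [mul_one, sum_const, nsmul_eq_mul, card_univ] at h3
    rw [sum_congr rfl fun b _ => mul_pow _ _ 3, ← mul_sum, h3, h.meetSum_one]
    have h4 := h.card_lines_mul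
    congr 1
    linear_combination (T : ℝ) ^ 2 * h4
  simp only [h2, sum_const, card_univ, nsmul_eq_mul] at h1
  have hL : (0 : ℝ) < Fintype.card L := by
    exact_mod_cast Fintype.card_pos_iff.2 h.nonempty_lines
  have hR : (1 : ℝ) < R := by exact_mod_cast h.one_lt_R
  have hRT : (T : ℝ) < R := by exact_mod_cast hTR
  have h5 := nonneg_of_mul_nonneg_right h1 hL
  have h6 := nonneg_of_mul_nonneg_right h5 (pow_pos hs 3)
  exact nonneg_of_mul_nonneg_right h6 (mul_pos (by linarith) (by linarith))

/-- The Hadamard square of the projection is positive definite. -/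
theorem proj_sq_posDef (hT : R ≤ 2 * T) (hT2 : T + 2 ≤ R) (w : L → ℝ) (hw : w ≠ 0) :
    0 < ∑ a, w a * ∑ b, proj I R T a b ^ 2 * w b := by
  have hexp : ∀ x y z : ℝ, ∑ a, w a * (x * w a + y * meetSum I w a + z * ∑ b, w b) =
      x * ∑ a, w a ^ 2 + y * ∑ a, w a * meetSum I w a + z * (∑ a, w a) ^ 2 := by
    intro x y z
    have hS : ∀ S : ℝ, ∑ a, w a * (x * w a + y * meetSum I w a + z * S) =
        x * ∑ a, w a ^ 2 + y * ∑ a, w a * meetSum I w a + z * S * ∑ a, w a := by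
      intro S
      rw [mul_sum, mul_sum, mul_sum, ← sum_add_distrib, ← sum_add_distrib]
      exact sum_congr rfl fun a _ => by ring
    rw [hS]
    ring
  have e1 : ∑ a, w a * ∑ b, proj I R T a b * w b =
      (((R : ℝ) - 1) * (R - T) - T) * ∑ a, w a ^ 2 - R * ∑ a, w a * meetSum I w a +
        T * (∑ a, w a) ^ 2 := by
    have h1 := sum_apply_proj (I := I) (R := R) (T := T) id w
    simp only [id] at h1
    simp only [h1]
    rw [hexp]
    ring
  have e2 : ∑ a, w a * ∑ b, proj I R T a b ^ 2 * w b =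
      ((((R : ℝ) - 1) * (R - T)) ^ 2 - T ^ 2) * ∑ a, w a ^ 2 -
        R * (2 * T - R) * ∑ a, w a * meetSum I w a + T ^ 2 * (∑ a, w a) ^ 2 := by
    have h1 := sum_apply_proj (I := I) (R := R) (T := T) (fun x => x ^ 2) w
    simp only [h1]
    rw [hexp]
    ring
  have e3 : 0 ≤ ∑ a, w a * ∑ b, proj I R T a b * w b := by
    have h1 := sum_gram_nonneg fun a c => w a * proj I R T a c
    have h2 : ∑ a, ∑ b, ∑ c, (w a * proj I R T a c) * (w b * proj I R T b c) =
        R * (K + R - 1 - T) * ∑ a, w a * ∑ b, proj I R T a b * w b := by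
      rw [mul_sum]
      refine sum_congr rfl fun a _ => ?_
      rw [mul_sum, mul_sum]
      refine sum_congr rfl fun b _ => ?_
      calc ∑ c, (w a * proj I R T a c) * (w b * proj I R T b c)
          = (w a * w b) * ∑ c, proj I R T a c * proj I R T b c := by
            rw [mul_sum]
            exact sum_congr rfl fun c _ => by ring
        _ = _ := by rw [h.proj_mul_proj]; ring
    rw [h2] at h1
    exact nonneg_of_mul_nonneg_right h1 h.scale_pos
  have hpos : 0 < ∑ a, w a ^ 2 := by
    obtain ⟨x, hx⟩ := Function.ne_iff.1 hw
    have : 0 < w x ^ 2 := by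
      have : w x ≠ 0 := hx
      positivity
    exact sum_pos' (fun a _ => sq_nonneg _) ⟨x, mem_univ _, this⟩
  rw [e1] at e3
  rw [e2]
  have hT' : (R : ℝ) ≤ 2 * T := by exact_mod_cast hT
  have hT2' : (T : ℝ) + 2 ≤ R := by exact_mod_cast hT2
  have hT0 : (0 : ℝ) < T := by exact_mod_cast h.T_pos
  -- With `E` for `proj`, `E∘E - (2T - R)E` is this constant times `I`, plus `T(R - T)J`, plus
  -- nothing on the meeting relation. The constant vanishes at `T = R - 1`, hence the need for `T +
  -- 2 ≤ R`.
  have hc : 0 < (R : ℝ) * (R - T) * ((R - 1) * (R - T) - T) := by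
    apply mul_pos (mul_pos _ _) <;> nlinarith
  have hd : 0 ≤ (T : ℝ) * (R - T) * (∑ a, w a) ^ 2 := by
    apply mul_nonneg (mul_nonneg _ _) (sq_nonneg _) <;> linarith
  have h4 := mul_nonneg (sub_nonneg.2 hT') e3
  have h5 := mul_pos hc hpos
  nlinarith

/-- The functions on lines whose sum over the lines on each point vanishes. -/
def pointSumZero (I : P → L → Prop) [∀ p a, Decidable (I p a)] : Submodule ℝ (L → ℝ) where
  carrier := {s | ∀ p, ∑ b ∈ univ.filter (I p ·), s b = 0}
  add_mem' := by
    intro s t hs ht p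
    simp only [Pi.add_apply, sum_add_distrib, hs p, ht p, add_zero]
  zero_mem' := by intro p; simp
  smul_mem' := by
    intro r s hs p
    simp only [Pi.smul_apply, smul_eq_mul, ← mul_sum, hs p, mul_zero]

/-- The scaled `proj` is a projection onto this space, so its trace is the dimension. -/
theorem finrank_pointSumZero :
    (Module.finrank ℝ (pointSumZero I) : ℝ) * (R * (K + R - 1 - T)) =
      Fintype.card L * ((R - 1) * (R - T)) := by
  have hs := h.scale_pos.ne'
  set κ : ℝ := R * (K + R - 1 - T) with hκ
  let M : Matrix L L ℝ := κ⁻¹ • Matrix.of (proj I R T)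
  have hM : ∀ s a, Matrix.toLin' M s a = κ⁻¹ * ∑ b, proj I R T a b * s b := by
    intro s a
    simp [M, Matrix.mulVec, dotProduct, mul_sum, mul_assoc]
  have hproj : LinearMap.IsProj (pointSumZero I) (Matrix.toLin' M) := by
    constructor
    · intro s p
      simp only [hM]
      rw [← mul_sum, sum_comm]
      have : ∀ b, ∑ a ∈ univ.filter (I p ·), proj I R T a b * s b = 0 := by
        intro b
        rw [← sum_mul]
        simp only [fun a => proj_symm (I := I) (R := R) (T := T) a b]
        rw [h.point_sums_proj b p, zero_mul]
      simp [this]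
    · intro s hs'
      ext a
      rw [hM, h.proj_mul_of_point_sums s hs' a, ← hκ, inv_mul_cancel_left₀ hs]
  have h1 := hproj.trace
  rw [Matrix.trace_toLin'_eq] at h1
  rw [← h1]
  simp only [Matrix.trace, M, Matrix.diag, Matrix.smul_apply, Matrix.of_apply, proj, if_true,
    sum_const, card_univ, nsmul_eq_mul, smul_eq_mul]
  field_simp

/-- The absolute bound for the lines of a partial geometry. -/
theorem absolute_bound (hT : R ≤ 2 * T) (hT2 : T + 2 ≤ R) :
    Fintype.card L ≤ Module.finrank ℝ (pointSumZero I) * Module.finrank ℝ (pointSumZero I) := by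
  by_contra! hcon
  set W := pointSumZero I
  -- Weights on lines are sent to bilinear forms on `W`. Evaluating at a pair of equal rows of
  -- `proj` gives the entries of `(E∘E)w`, so positive definiteness of `E∘E` makes `Φ` injective.
  let Φ : (L → ℝ) →ₗ[ℝ] (W →ₗ[ℝ] (W →ₗ[ℝ] ℝ)) :=
    { toFun := fun w => LinearMap.mk₂ ℝ (fun s t => ∑ b, w b * ((s : L → ℝ) b * (t : L → ℝ) b))
        (by intro s s' t; simp [add_mul, mul_add, sum_add_distrib])
        (by intro c s t; simp [mul_sum, mul_left_comm, mul_assoc])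
        (by intro s t t'; simp [mul_add, sum_add_distrib])
        (by intro c s t; simp [mul_sum, mul_left_comm])
      map_add' := by intro w w'; ext s t; simp [add_mul, sum_add_distrib]
      map_smul' := by intro c w; ext s t; simp [mul_sum, mul_assoc] }
  have hker : LinearMap.ker Φ ≠ ⊥ := by
    have : FiniteDimensional ℝ (W →ₗ[ℝ] (W →ₗ[ℝ] ℝ)) := inferInstance
    refine LinearMap.ker_ne_bot_of_finrank_lt (K := ℝ) (V := L → ℝ)
      (V₂ := W →ₗ[ℝ] (W →ₗ[ℝ] ℝ)) (f := Φ) ?_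
    rw [Module.finrank_linearMap, Module.finrank_linearMap, Module.finrank_self, mul_one]
    simpa using hcon
  obtain ⟨w, hw, hw0⟩ := (Submodule.ne_bot_iff _).1 hker
  rw [LinearMap.mem_ker] at hw
  have h1 : ∀ a, ∑ b, proj I R T a b ^ 2 * w b = 0 := by
    intro a
    have h2 := LinearMap.congr_fun (LinearMap.congr_fun hw ⟨_, h.point_sums_proj a⟩)
      ⟨_, h.point_sums_proj a⟩
    simp only [Φ, LinearMap.coe_mk, AddHom.coe_mk, LinearMap.mk₂_apply,
      LinearMap.zero_apply] at h2
    rw [← h2]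
    exact sum_congr rfl fun b _ => by ring
  have h2 := h.proj_sq_posDef hT hT2 w hw0
  simp only [h1, mul_zero, sum_const_zero] at h2
  exact lt_irrefl _ h2

/-- In a partial geometry with `T ≤ R - 2` the lines are not too long. -/
theorem K_le (hT2 : T + 2 ≤ R) : K ≤ 2 * R ^ 2 * T := by
  have hK1 : (1 : ℝ) < K := by exact_mod_cast h.one_lt_K
  have hT2' : (T : ℝ) + 2 ≤ R := by exact_mod_cast hT2
  have hT0 : (1 : ℝ) ≤ T := by exact_mod_cast h.T_pos
  suffices hsuff : (K : ℝ) ≤ 2 * R ^ 2 * T by exact_mod_cast hsuff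
  -- The Krein inequality bounds `K` only if the coefficient `T² - (R - T)² = R(2T - R)` of `K` is
  -- negative. Otherwise the absolute bound applies, with dimension at most `2(R - 1)(R - T)`.
  rcases Nat.lt_or_ge (2 * T) R with hT | hT
  · have h1 := h.krein (by omega)
    have hT' : 2 * (T : ℝ) + 1 ≤ R := by exact_mod_cast hT
    have h2 : (R : ℝ) ^ 2 * (R - T) ^ 2 ≤ R ^ 2 * (2 * T * R * (R - 2 * T)) := by
      apply mul_le_mul_of_nonneg_left _ (sq_nonneg _)
      have h3 := mul_nonneg (sub_nonneg.2 hT0) (sub_nonneg.2 hT')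
      have h4 := mul_nonneg (by linarith : (0 : ℝ) ≤ 4 * R + 1) h3
      nlinarith
    have h3 : (K : ℝ) * (R * (R - 2 * T)) ≤ (R - 1) ^ 2 * (R - T) ^ 2 := by nlinarith
    have h4 : ((R : ℝ) - 1) ^ 2 * (R - T) ^ 2 ≤ R ^ 2 * (R - T) ^ 2 := by
      apply mul_le_mul_of_nonneg_right _ (sq_nonneg _)
      nlinarith
    have h5 : 0 < (R : ℝ) * (R - 2 * T) := by apply mul_pos <;> linarith
    refine le_of_mul_le_mul_right ?_ h5
    nlinarith
  · have h1 := h.absolute_bound hT hT2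
    have h2 := h.finrank_pointSumZero
    have h3 := h.card_lines_mul
    set g := Module.finrank ℝ (pointSumZero I)
    have hT' : (R : ℝ) ≤ 2 * T := by exact_mod_cast hT
    have h4 : (g : ℝ) ≤ 2 * (R - 1) * (R - T) := by
      have hs := h.scale_pos
      refine le_of_mul_le_mul_right ?_ hs
      rw [h2]
      refine le_of_mul_le_mul_right ?_ (by linarith : (0 : ℝ) < T)
      have h5 : (Fintype.card L : ℝ) * T ≤ 2 * (R * (K + R - 1 - T)) * T := by
        rw [h3]
        have h6 : (T : ℝ) + (K - 1) * (R - 1) ≤ 2 * (K + R - 1 - T) * T := by nlinarith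
        have h7 := mul_le_mul_of_nonneg_left h6 (by linarith : (0 : ℝ) ≤ R)
        linarith
      have h6 : 0 ≤ ((R : ℝ) - 1) * (R - T) := by apply mul_nonneg <;> linarith
      have h7 := mul_le_mul_of_nonneg_left h5 h6
      linarith
    have h5 : (Fintype.card L : ℝ) ≤ (2 * (R - 1) * (R - T)) ^ 2 := by
      have h6 : (Fintype.card L : ℝ) ≤ g * g := by exact_mod_cast h1
      have h7 : (0 : ℝ) ≤ g := by positivity
      nlinarith
    have h6 : (R : ℝ) * (K - 1) * (R - 1) ≤ (2 * (R - 1) * (R - T)) ^ 2 * T := by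
      have h7 := mul_le_mul_of_nonneg_right h5 (by linarith : (0 : ℝ) ≤ T)
      nlinarith
    have h7 : (K - 1 : ℝ) * (R * (R - 1)) ≤ (R ^ 2 * T) * (R * (R - 1)) := by
      have h8 : (2 * ((R : ℝ) - T)) ^ 2 ≤ R ^ 2 := by
        apply pow_le_pow_left₀ <;> linarith
      have h9 : (2 * ((R : ℝ) - 1) * (R - T)) ^ 2 * T ≤ (R - 1) ^ 2 * T * R ^ 2 := by
        have := mul_le_mul_of_nonneg_left h8 (by positivity : 0 ≤ ((R : ℝ) - 1) ^ 2 * T)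
        linarith
      have h10 : ((R : ℝ) - 1) ^ 2 * T * R ^ 2 ≤ (R ^ 2 * T) * (R * (R - 1)) := by
        have : 0 ≤ (R : ℝ) ^ 2 * T := by positivity
        nlinarith
      linarith
    have h8 : (0 : ℝ) < R * (R - 1) := by apply mul_pos <;> linarith
    have h9 := le_of_mul_le_mul_right h7 h8
    nlinarith

end FinitePG

end SRGBound

/-! ### The extreme geometries: dual designs and nets -/

namespace SRGBound

open Finset

universe u

namespace FinitePG

section

variable {P L : Type u} [Fintype P] [Fintype L] [DecidableEq P] [DecidableEq L]
  {I : P → L → Prop} [∀ p a, Decidable (I p a)] {K R T : ℕ} (h : FinitePG I K R T)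
include h

theorem exists_point : Nonempty P := by
  obtain ⟨a⟩ := h.nonempty_lines
  have h1 := h.order_line a
  have h2 := h.one_lt_K
  obtain ⟨p, -⟩ : (univ.filter fun p => I p a).Nonempty := card_pos.1 (by omega)
  exact ⟨p⟩

theorem isPartialGeometry : IsPartialGeometry I K R T where
  one_lt_K := h.one_lt_K
  one_lt_R := h.one_lt_R
  T_pos := h.T_pos
  nonempty_points := h.exists_point
  nonempty_lines := h.nonempty_lines
  line_unique := h.line_unique
  order_line a := by
    rw [← h.order_line a, ← Set.ncard_coe_finset]
    congr 1
    ext; simp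
  order_point p := by
    rw [← h.order_point p, ← Set.ncard_coe_finset]
    congr 1
    ext; simp
  meeting a p hp := by
    rw [← h.meeting a p hp, ← Set.ncard_coe_finset]
    congr 1
    ext; simp

theorem isCollinearityGraph {G : SimpleGraph P}
    (hG : ∀ p q, G.Adj p q ↔ p ≠ q ∧ ∃ a, I p a ∧ I q a) : IsCollinearityGraph G K R T :=
  ⟨P, L, I, h.isPartialGeometry, ⟨{ toEquiv := Equiv.refl P, map_rel_iff' := (hG _ _).symm }⟩⟩

end

section Dual

variable {P L : Type u} [Fintype P] [Fintype L] [DecidableEq P] [DecidableEq L]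
  {I : P → L → Prop} [∀ p a, Decidable (I p a)] {K R : ℕ} (h : FinitePG I K R R)
include h

/-- If `T = R` then any two lines meet. -/
theorem lines_meet (a b : L) : ∃ p, I p a ∧ I p b := by
  have h1 := h.order_line b
  have h2 := h.one_lt_K
  obtain ⟨p, hp⟩ : (univ.filter fun p => I p b).Nonempty := card_pos.1 (by omega)
  have hpb : I p b := by simpa using hp
  by_cases hpa : I p a
  · exact ⟨p, hpa, hpb⟩
  · have h3 : (univ.filter fun c : L => I p c ∧ ∃ q : P, I q c ∧ I q a) =
        univ.filter fun c => I p c := by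
      apply eq_of_subset_of_card_le
      · intro c hc
        simp only [mem_filter, mem_univ, true_and] at hc ⊢
        exact hc.1
      · rw [h.meeting a p hpa, h.order_point p]
    have h4 : b ∈ univ.filter fun c => I p c := by simpa using hpb
    rw [← h3] at h4
    obtain ⟨q, hq⟩ := (mem_filter.1 h4).2.2
    exact ⟨q, hq.2, hq.1⟩

theorem card_lines_dual : Fintype.card L = R + (K - 1) * (R - 1) := by
  have h1 := h.card_lines_mul
  have hK := h.one_lt_K
  have hR := h.one_lt_R
  have hR0 : (R : ℝ) ≠ 0 := by exact_mod_cast (by omega : R ≠ 0)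
  have h2 : (Fintype.card L : ℝ) = R + (K - 1) * (R - 1) := by
    apply mul_right_cancel₀ hR0
    rw [h1]
    ring
  have h3 : ((R + (K - 1) * (R - 1) : ℕ) : ℝ) = R + (K - 1) * (R - 1) := by
    push_cast [Nat.cast_sub hK.le, Nat.cast_sub hR.le]
    ring
  rw [← h3] at h2
  exact_mod_cast h2

/-- A partial geometry with `T = R` is the dual of a `2`-design. -/
theorem isBlockGraph {G : SimpleGraph P}
    (hG : ∀ p q, G.Adj p q ↔ p ≠ q ∧ ∃ a, I p a ∧ I q a) :
    IsBlockGraph G (R + (K - 1) * (R - 1)) R 1 := by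
  refine ⟨L, P, fun a p => I p a, ?_, ⟨{ toEquiv := Equiv.refl P, map_rel_iff' := ?_ }⟩⟩
  · refine ⟨h.one_lt_R, by omega, ?_, ?_, ?_⟩
    · rw [Nat.card_eq_fintype_card, h.card_lines_dual]
    · exact h.isPartialGeometry.order_point
    · intro a b hab
      obtain ⟨p, hpa, hpb⟩ := h.lines_meet a b
      rw [Set.ncard_eq_one]
      refine ⟨p, Set.eq_singleton_iff_unique_mem.2 ⟨⟨hpa, hpb⟩, ?_⟩⟩
      rintro q ⟨hqa, hqb⟩
      by_contra hqp
      exact hab (h.line_unique q p hqp a b hqa hpa hqb hpb)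
  · intro p q
    exact (hG p q).symm

end Dual

section Net

variable {P L : Type u} [Fintype P] [Fintype L] [DecidableEq P] [DecidableEq L]
  {I : P → L → Prop} [∀ p a, Decidable (I p a)] {K R T : ℕ}

/-- Two lines are parallel if they are equal or disjoint. -/
def Parallel (I : P → L → Prop) (a b : L) : Prop := a = b ∨ ¬ ∃ p, I p a ∧ I p b

omit [Fintype P] [Fintype L] [DecidableEq P] [DecidableEq L] [∀ p a, Decidable (I p a)] in
theorem Parallel.symm {a b : L} (hab : Parallel I a b) : Parallel I b a := by
  rcases hab with rfl | hab
  · exact Or.inl rfl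
  · exact Or.inr fun ⟨p, h1, h2⟩ => hab ⟨p, h2, h1⟩

variable (h : FinitePG I K R T) (hT : T + 1 = R)
include h hT

/-- Of the `R` lines on a point off `a`, exactly `T = R - 1` meet `a`. -/
theorem exists_unique_parallel (p : P) (a : L) : ∃! b, I p b ∧ Parallel I b a := by
  by_cases hp : I p a
  · refine ⟨a, ⟨hp, Or.inl rfl⟩, ?_⟩
    rintro b ⟨hpb, rfl | hb⟩
    · rfl
    · exact absurd ⟨p, hpb, hp⟩ hb
  · have h1 := card_filter_add_card_filter_not (s := univ.filter fun b => I p b)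
      (fun b => ∃ q : P, I q b ∧ I q a)
    rw [filter_filter, h.meeting a p hp, h.order_point p] at h1
    obtain ⟨b, hb⟩ := card_eq_one.1 (show ((univ.filter fun b => I p b).filter
      fun b => ¬ ∃ q : P, I q b ∧ I q a).card = 1 by omega)
    have hiff : ∀ c, (I p c ∧ Parallel I c a) ↔ c = b := by
      intro c
      rw [← mem_singleton, ← hb, mem_filter, mem_filter]
      constructor
      · rintro ⟨hpc, rfl | hc⟩
        · exact absurd hpc hp
        · exact ⟨⟨mem_univ _, hpc⟩, hc⟩
      · rintro ⟨⟨-, hpc⟩, hc⟩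
        exact ⟨hpc, Or.inr hc⟩
    exact ⟨b, (hiff b).2 rfl, fun c hc => (hiff c).1 hc⟩

theorem parallel_trans {a b c : L} (hab : Parallel I a b) (hbc : Parallel I b c) :
    Parallel I a c := by
  by_contra hac
  simp only [Parallel, not_or, not_not] at hac
  obtain ⟨hne, p, hpa, hpc⟩ := hac
  exact hne ((h.exists_unique_parallel hT p b).unique ⟨hpa, hab⟩ ⟨hpc, hbc.symm⟩)

theorem card_points_net : Fintype.card P = K ^ 2 := by
  have h1 := h.card_lines_mul
  have hR := h.one_lt_R
  have hR0 : (R : ℝ) ≠ 0 := by exact_mod_cast (by omega : R ≠ 0)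
  have hT0 : (T : ℝ) ≠ 0 := by exact_mod_cast h.T_pos.ne'
  have hT' : (R : ℝ) = T + 1 := by exact_mod_cast hT.symm
  have h2 : (Fintype.card L : ℝ) = R * K := by
    apply mul_right_cancel₀ hT0
    rw [h1, hT']
    ring
  have h3 : Fintype.card P * R = Fintype.card L * K := by
    have e1 : ∑ p, (univ.filter fun a => I p a).card = Fintype.card P * R := by
      simp [h.order_point]
    have e2 : ∑ a, (univ.filter fun p => I p a).card = Fintype.card L * K := by
      simp [h.order_line]
    rw [← e1, ← e2]
    simp only [card_filter]
    exact sum_comm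
  have h4 : Fintype.card L = R * K := by exact_mod_cast h2
  rw [h4] at h3
  apply Nat.eq_of_mul_eq_mul_right (show 0 < R by omega)
  rw [h3]
  ring

/-- The lines parallel to `a` partition the `K²` points into sets of size `K`. -/
theorem card_parallel_class (a : L) : Nat.card {b // Parallel I b a} = K := by
  classical
  rw [Nat.card_eq_fintype_card, Fintype.card_subtype]
  have e1 : ∑ p, ∑ b ∈ univ.filter (fun b => Parallel I b a), (if I p b then 1 else 0) =
      Fintype.card P := by
    rw [← card_univ, card_eq_sum_ones]
    refine sum_congr rfl fun p _ => ?_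
    rw [← card_filter, filter_filter, card_eq_one]
    obtain ⟨b, hb, hu⟩ := h.exists_unique_parallel hT p a
    refine ⟨b, eq_singleton_iff_unique_mem.2 ⟨by simpa using hb.symm, fun c hc => ?_⟩⟩
    exact hu c (by simpa using (mem_filter.1 hc).2.symm)
  rw [sum_comm] at e1
  have e2 : ∀ b ∈ univ.filter (fun b => Parallel I b a), ∑ p, (if I p b then 1 else 0) = K := by
    intro b _
    rw [← card_filter, h.order_line b]
  rw [sum_congr rfl e2, sum_const, smul_eq_mul, h.card_points_net hT, sq] at e1
  have := h.one_lt_K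
  exact Nat.eq_of_mul_eq_mul_right (by omega) e1

/-- A partial geometry with `T = R - 1` is a net; its collinearity graph is a Latin square
graph. -/
theorem isLatinSquareGraph {G : SimpleGraph P}
    (hG : ∀ p q, G.Adj p q ↔ p ≠ q ∧ ∃ a, I p a ∧ I q a) : IsLatinSquareGraph G R K := by
  classical
  obtain ⟨p₀⟩ := h.exists_point
  -- The lines on one fixed point represent the parallel classes, which index the rows. Columns are
  -- points, and an entry labels the line of that class on that point.
  let d : Fin R ≃ {b // I p₀ b} := Fintype.equivOfCardEq (by
    rw [Fintype.card_fin, Fintype.card_subtype, h.order_point p₀])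
  have hcls : ∀ i, Nonempty ({b // Parallel I b (d i : L)} ≃ Fin K) := fun i =>
    ⟨Fintype.equivOfCardEq (by
      rw [Fintype.card_fin, ← Nat.card_eq_fintype_card, h.card_parallel_class hT])⟩
  let cls := fun i => (hcls i).some
  let eP : P ≃ Fin (K ^ 2) := Fintype.equivOfCardEq (by
    rw [Fintype.card_fin, h.card_points_net hT])
  choose ln hln hlnu using fun (p : P) (a : L) => h.exists_unique_parallel hT p a
  let A : Fin R → Fin (K ^ 2) → Fin K := fun i c =>
    cls i ⟨ln (eP.symm c) (d i), (hln (eP.symm c) (d i)).2⟩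
  have hA : ∀ i c c', A i c = A i c' ↔ ln (eP.symm c) (d i) = ln (eP.symm c') (d i) := by
    intro i c c'
    simp only [A, EmbeddingLike.apply_eq_iff_eq, Subtype.mk.injEq]
  refine ⟨A, ?_, ⟨{ toEquiv := eP, map_rel_iff' := ?_ }⟩⟩
  · intro i j hij c c' hcc
    simp only [Prod.mk.injEq, hA] at hcc
    by_contra hne
    have hne' : eP.symm c ≠ eP.symm c' := fun h => hne (eP.symm.injective h)
    set p := eP.symm c
    set p' := eP.symm c'
    have h1 : ln p (d i) = ln p (d j) := by
      refine h.line_unique p p' hne' _ _ (hln p _).1 ?_ (hln p _).1 ?_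
      · rw [hcc.1]; exact (hln p' _).1
      · rw [hcc.2]; exact (hln p' _).1
    have h2 : Parallel I (d i : L) (d j) :=
      h.parallel_trans hT (hln p (d i)).2.symm (h1 ▸ (hln p (d j)).2)
    rcases h2 with h2 | h2
    · exact hij (d.injective (Subtype.ext h2))
    · exact h2 ⟨p₀, (d i).2, (d j).2⟩
  · intro p q
    have hiff : (∃ i, A i (eP p) = A i (eP q)) ↔ ∃ a, I p a ∧ I q a := by
      simp only [hA, Equiv.symm_apply_apply]
      constructor
      · rintro ⟨i, hi⟩
        exact ⟨ln p (d i), (hln p _).1, hi ▸ (hln q _).1⟩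
      · rintro ⟨a, hpa, hqa⟩
        obtain ⟨i, hi⟩ := d.surjective ⟨ln p₀ a, (hln p₀ a).1⟩
        have hpar : Parallel I a (d i : L) := by
          rw [hi]
          exact (hln p₀ a).2.symm
        refine ⟨i, ?_⟩
        rw [← hlnu p (d i) a ⟨hpa, hpar⟩, ← hlnu q (d i) a ⟨hqa, hpar⟩]
    change (eP p ≠ eP q ∧ ∃ i, A i (eP p) = A i (eP q)) ↔ G.Adj p q
    rw [hG, hiff, eP.injective.ne_iff]

end Net

end FinitePG

end SRGBound

/-! ### From the strongly regular graph to its geometry -/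

namespace SRGBound

open Finset

section Setup

variable {V : Type*} [Fintype V] [DecidableEq V] {G : SimpleGraph V} [DecidableRel G.Adj]

omit [DecidableEq V] in
theorem adjMatrix_mulVec_eq_nbrSum (u : V → ℝ) (x : V) :
    (G.adjMatrix ℝ).mulVec u x = nbrSum G u x :=
  SimpleGraph.adjMatrix_mulVec_apply _ _ _

/-- An eigenvalue of `A + tI` is an eigenvalue of `A` shifted by `t`, hence non-negative. -/
theorem IsSmallestEigenvalue.psd {t : ℝ} (h : IsSmallestEigenvalue G (-t)) (u : V → ℝ) :
    0 ≤ ∑ x, u x * nbrSum G u x + t * ∑ x, u x ^ 2 := by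
  let B : Matrix V V ℝ := G.adjMatrix ℝ + t • 1
  have hBu : ∀ u x, B.mulVec u x = nbrSum G u x + t * u x := by
    intro u x
    simp [B, Matrix.add_mulVec, Matrix.smul_mulVec, nbrSum]
  have hB : B.IsHermitian := by
    rw [Matrix.IsHermitian, Matrix.conjTranspose_eq_transpose_of_trivial]
    simp [B, Matrix.transpose_add, Matrix.transpose_smul]
  have hpos : B.PosSemidef := by
    rw [hB.posSemidef_iff_eigenvalues_nonneg]
    intro i
    have h1 := hB.mulVec_eigenvectorBasis i
    set w : V → ℝ := ⇑(hB.eigenvectorBasis i) with hw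
    have hw0 : w ≠ 0 := by
      intro h0
      have h2 := hB.eigenvectorBasis.orthonormal.ne_zero i
      apply h2
      ext x
      exact congrFun h0 x
    have h2 : Module.End.HasEigenvalue (Matrix.toLin' (G.adjMatrix ℝ)) (hB.eigenvalues i - t) := by
      refine Module.End.hasEigenvalue_of_hasEigenvector (x := w)
        ⟨Module.End.mem_eigenspace_iff.2 ?_, hw0⟩
      ext x
      have h3 := congrFun h1 x
      rw [hBu] at h3
      rw [Matrix.toLin'_apply, adjMatrix_mulVec_eq_nbrSum]
      simp only [Pi.smul_apply, smul_eq_mul] at h3 ⊢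
      linarith
    have h3 := h.2 h2
    change 0 ≤ hB.eigenvalues i
    linarith
  have h1 := hpos.dotProduct_mulVec_nonneg u
  simp only [dotProduct, hBu, star_trivial] at h1
  rw [mul_sum, ← sum_add_distrib]
  refine h1.trans_eq (sum_congr rfl fun x _ => by ring)

omit [Fintype V] [DecidableEq V] [DecidableRel G.Adj] in
theorem exists_induced_path (hc : G.Connected) (ht : G ≠ ⊤) :
    ∃ x y z, G.Adj x y ∧ G.Adj y z ∧ x ≠ z ∧ ¬ G.Adj x z := by
  by_contra! hcon
  have h1 : ∀ x z, G.Walk x z → x = z ∨ G.Adj x z := by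
    intro x z p
    induction p with
    | nil => exact Or.inl rfl
    | @cons a b c hab p ih =>
      rcases ih with rfl | h
      · exact Or.inr hab
      · by_cases hac : a = c
        · exact Or.inl hac
        · exact Or.inr (hcon a b c hab h hac)
  apply ht
  ext x z
  rw [SimpleGraph.top_adj]
  constructor
  · exact fun h => h.ne
  · intro hne
    obtain ⟨p⟩ := hc.preconnected x z
    exact (h1 x z p).resolve_left hne

/-- The eigenvalue `-m` of a strongly regular graph determines its valency. -/
theorem valency_eq {k l μ : ℕ} {t : ℝ} (ht : 0 < t) (hk : ∀ x, (G.neighborFinset x).card = k)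
    (hl : ∀ x y, G.Adj x y → (G.neighborFinset x ∩ G.neighborFinset y).card = l)
    (hμ : ∀ x y, x ≠ y → ¬ G.Adj x y → (G.neighborFinset x ∩ G.neighborFinset y).card = μ)
    (h : IsSmallestEigenvalue G (-t)) : (k : ℝ) = μ + t * (l - μ + t) := by
  obtain ⟨w, hw, hw0⟩ := h.1.exists_hasEigenvector
  rw [Module.End.mem_eigenspace_iff, Matrix.toLin'_apply] at hw
  have hn : ∀ x, nbrSum G w x = -t * w x := by
    intro x
    rw [← adjMatrix_mulVec_eq_nbrSum, hw]
    rfl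
  -- A `-t`-eigenvector is orthogonal to constants because `k + t > 0`; this removes the `J` term
  -- from the identity for `A²`.
  have hsum : ∑ x, w x = 0 := by
    have h1 := sum_nbrSum hk w
    simp only [hn, ← mul_sum] at h1
    have h2 : ((k : ℝ) + t) * ∑ x, w x = 0 := by linarith
    exact (mul_eq_zero.1 h2).resolve_left (by positivity)
  obtain ⟨x, hx⟩ := Function.ne_iff.1 hw0
  have h1 := nbrSum_nbrSum hk hl hμ w x
  have h2 : nbrSum G (nbrSum G w) x = t ^ 2 * w x := by
    have : nbrSum G w = fun y => -t * w y := funext hn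
    rw [this, nbrSum, ← mul_sum]
    change -t * nbrSum G w x = _
    rw [hn]
    ring
  rw [h2, hn, hsum] at h1
  apply mul_right_cancel₀ (show w x ≠ 0 from hx)
  linarith

omit [DecidableEq V] in
theorem IsPrimitiveSRG.card_nbr {v k l μ : ℕ} (hG : IsPrimitiveSRG G v k l μ) (x : V) :
    (G.neighborFinset x).card = k := by
  rw [SimpleGraph.card_neighborFinset_eq_degree]
  exact hG.isSRGWith.regular x

theorem card_commonNeighbors_eq (x y : V) :
    Fintype.card (G.commonNeighbors x y) = (G.neighborFinset x ∩ G.neighborFinset y).card := by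
  rw [← Set.toFinset_card]
  congr 1
  ext z
  simp [SimpleGraph.mem_commonNeighbors]

theorem IsPrimitiveSRG.card_adj {v k l μ : ℕ} (hG : IsPrimitiveSRG G v k l μ) (x y : V)
    (hxy : G.Adj x y) : (G.neighborFinset x ∩ G.neighborFinset y).card = l := by
  rw [← card_commonNeighbors_eq, ← hG.isSRGWith.of_adj x y hxy]

theorem IsPrimitiveSRG.card_not_adj {v k l μ : ℕ} (hG : IsPrimitiveSRG G v k l μ) (x y : V)
    (hne : x ≠ y) (hxy : ¬ G.Adj x y) : (G.neighborFinset x ∩ G.neighborFinset y).card = μ := by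
  rw [← card_commonNeighbors_eq, ← hG.isSRGWith.of_not_adj hne hxy]

theorem IsPrimitiveSRG.mu_pos {v k l μ : ℕ} (hG : IsPrimitiveSRG G v k l μ) : 0 < μ := by
  obtain ⟨x, y, z, hxy, hyz, hne, hn⟩ := exists_induced_path hG.connected hG.ne_top
  rw [← hG.card_not_adj x z hne hn]
  exact card_pos.2 ⟨y, by simp [hxy, hyz.symm]⟩

/-- For `m = 1` the valency equation gives `k = l + 1`, so adjacent vertices have the same closed
neighbourhood and no induced path exists. -/
theorem IsPrimitiveSRG.two_le {v k l μ m : ℕ} (hG : IsPrimitiveSRG G v k l μ)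
    (hm : 0 < m) (hmin : IsSmallestEigenvalue G (-(m : ℝ))) : 2 ≤ m := by
  by_contra! hcon
  obtain rfl : m = 1 := by omega
  have hk := valency_eq (by simp) hG.card_nbr hG.card_adj hG.card_not_adj hmin
  have hk' : k = l + 1 := by
    have : (k : ℝ) = l + 1 := by rw [hk]; push_cast; ring
    exact_mod_cast this
  obtain ⟨x, y, z, hxy, hyz, hne, hn⟩ := exists_induced_path hG.connected hG.ne_top
  have h1 : insert x (G.neighborFinset y ∩ G.neighborFinset x) = G.neighborFinset y := by
    apply eq_of_subset_of_card_le
    · intro w hw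
      rcases mem_insert.1 hw with rfl | hw
      · simpa using hxy.symm
      · exact (mem_inter.1 hw).1
    · rw [card_insert_of_notMem (by simp), hG.card_nbr, hG.card_adj y x hxy.symm, hk']
  have h2 : z ∈ insert x (G.neighborFinset y ∩ G.neighborFinset x) := by
    rw [h1]; simpa using hyz
  simp [hne.symm, hn] at h2

/-- The data of a primitive strongly regular graph whose `l` exceeds the bound. -/
theorem IsPrimitiveSRG.spectralData {v k l μ m : ℕ} (hG : IsPrimitiveSRG G v k l μ)
    (hm : 0 < m) (hmin : IsSmallestEigenvalue G (-(m : ℝ))) (hf : f m μ < l) :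
    SpectralData G k l μ m where
  card_nbr := hG.card_nbr
  card_adj := hG.card_adj
  card_not_adj := hG.card_not_adj
  nonempty := hG.connected.nonempty
  two_le := hG.two_le hm hmin
  mu_pos := hG.mu_pos
  k_eq := valency_eq (by exact_mod_cast hm) hG.card_nbr hG.card_adj hG.card_not_adj hmin
  psd := hmin.psd
  mu_le := by
    have h1 : (1 : ℝ) ≤ μ := by exact_mod_cast hG.mu_pos
    have h2 : (2 : ℝ) ≤ m := by exact_mod_cast hG.two_le hm hmin
    have h3 : (μ : ℝ) ≤ l := by
      rw [f] at hf
      nlinarith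
    exact_mod_cast h3

namespace SpectralData

variable {k l μ m : ℕ} (h : SpectralData G k l μ m)
include h

/-- A claw has at most `4m/3` leaves if `l` exceeds the bound. -/
theorem claw_card_le (hf : f m μ < l) (x : V) (I : Finset V) (hI : ∀ y ∈ I, G.Adj x y)
    (hind : ∀ y ∈ I, ∀ z ∈ I, ¬ G.Adj y z) : I.card ≤ 4 * m / 3 := by
  by_contra! hcon
  obtain ⟨J, hJI, hJ⟩ := exists_subset_card_eq (show 4 * m / 3 + 1 ≤ I.card from hcon)
  have hμ1 := h.mu_pos
  obtain ⟨X, rfl⟩ : ∃ X, μ = X + 1 := ⟨μ - 1, by omega⟩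
  have hb := claw_bound h.card_nbr h.card_adj
    (fun x y h1 h2 => (h.card_not_adj x y h1 h2).le) x J (fun y hy => hI y (hJI hy))
    (fun y hy z hz => hind y (hJI hy) z (hJI hz))
  have hkeq := h.k_eq
  have h2 : (2 : ℝ) ≤ m := by exact_mod_cast h.two_le
  obtain ⟨σ, hσ⟩ : ∃ σ : ℕ, J.card = σ := ⟨_, rfl⟩
  rw [hσ] at hb
  have hb' : 2 * (σ : ℝ) * (l + 1) ≤ 2 * k + σ * (σ - 1) * X := by exact_mod_cast hb
  have hX : (0 : ℝ) ≤ X := by positivity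
  rw [f] at hf
  push_cast at hf hkeq
  -- `j ∈ {1, 2, 3}` absorbs the rounding in `⌊4m/3⌋ + 1`. By `k_eq`, `k - m(l + 1) = (m - 1)² - (m
  -- - 1)X`, so the claw bound limits `(m + j)/3 * (l + 1)`.
  have key : ∀ j : ℝ, 1 ≤ j → j ≤ 3 → (σ : ℝ) = (4 * m + j) / 3 → False := by
    intro j hj1 hj3 hσj
    rw [hσj, hkeq] at hb'
    have e1 : ((m : ℝ) + j) / 3 * (8 / 3 * m * X - 2 / 3 * X + 3 * m - 3) <
        (m + j) / 3 * (l + 1) := by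
      apply mul_lt_mul_of_pos_left <;> linarith
    have e2 : ((m : ℝ) + j) / 3 * (3 * m - 3) ≥ (m - 1) ^ 2 := by nlinarith
    have e3 : 0 ≤ (((m : ℝ) + j) / 3 * (8 / 3 * m - 2 / 3) + (m - 1) -
        (4 * m + j) / 3 * ((4 * m + j) / 3 - 1) / 2) := by nlinarith
    have e4 := mul_nonneg e3 hX
    nlinarith
  have h3 : 3 * σ = 4 * m + 1 ∨ 3 * σ = 4 * m + 2 ∨ 3 * σ = 4 * m + 3 := by omega
  rcases h3 with h3 | h3 | h3
  · have : 3 * (σ : ℝ) = 4 * m + 1 := by exact_mod_cast h3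
    exact key 1 (by norm_num) (by norm_num) (by linarith)
  · have : 3 * (σ : ℝ) = 4 * m + 2 := by exact_mod_cast h3
    exact key 2 (by norm_num) (by norm_num) (by linarith)
  · have : 3 * (σ : ℝ) = 4 * m + 3 := by exact_mod_cast h3
    exact key 3 (by norm_num) (by norm_num) (by linarith)

/-- If `l` exceeds the bound, then there are lines, exactly `m` on each vertex. -/
theorem exists_lines (hf : f m μ < l) (hne : ∃ x y, x ≠ y ∧ ¬ G.Adj x y) :
    ∃ F, LineSystem G F ∧ ∀ x, (F.filter (x ∈ ·)).card = m := by
  have hclaw := h.claw_card_le hf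
  have hm := h.two_le
  set s := 4 * m / 3 with hs
  have hs3 : 3 * s ≤ 4 * m := by omega
  have hμ1 := h.mu_pos
  obtain ⟨X, hXμ⟩ : ∃ X, μ = X + 1 := ⟨μ - 1, by omega⟩
  have h2 : (2 : ℝ) ≤ m := by exact_mod_cast hm
  have hs3' : 3 * (s : ℝ) ≤ 4 * m := by exact_mod_cast hs3
  have hX : (0 : ℝ) ≤ X := by positivity
  have hl : 8 / 3 * (m : ℝ) * X - 2 / 3 * X + 3 * m - 4 < l := by
    rw [f, hXμ] at hf
    push_cast at hf
    linarith
  have hsX := mul_le_mul_of_nonneg_right hs3' hX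
  obtain ⟨F, hF, hbig, hFs⟩ := exists_lineSystem (X := X) (s := s) h.card_adj
    (fun x y h1 h2 => by rw [h.card_not_adj x y h1 h2, hXμ]) (by
      have : 2 * (s : ℝ) * X < l + 1 + X := by linarith
      exact_mod_cast this) hclaw
  -- The clique size `l + 2 + X - sX`, estimated with `3s ≤ 4m`.
  have hbig' : ∀ c ∈ F, 4 / 3 * (m : ℝ) * X + X / 3 + 3 * m - 2 < c.card := by
    intro c hc
    have h3 : (l : ℝ) + 2 + X ≤ c.card + s * X := by exact_mod_cast hbig c hc
    linarith
  have hmX : (0 : ℝ) ≤ 4 / 3 * (m : ℝ) * X := by positivity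
  have hbig2 : ∀ c ∈ F, 2 * s ≤ c.card := by
    intro c hc
    have h3 : 3 * (m : ℝ) < c.card + 2 := by
      have := hbig' c hc
      linarith
    have h4 : 3 * m < c.card + 2 := by exact_mod_cast h3
    omega
  have hout : ∀ c ∈ F, ∃ y, y ∉ c := by
    intro c hc
    by_contra! hall
    obtain ⟨x, y, hxy, hn⟩ := hne
    exact hn ((hF.maxClique c hc).1 x (hall x) y (hall y) hxy)
  have hdvd := h.dvd_mu hF hFs hbig2 hout
  -- Divisibility raises the lower bound on `X` to `m - 1`, which is what lifts the line size from
  -- `2s` to `m * s`.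
  have hmμ : (m : ℝ) ≤ X + 1 := by
    have := Nat.le_of_dvd hμ1 hdvd
    rw [hXμ] at this
    exact_mod_cast this
  refine ⟨F, hF, h.card_lines_eq hF hFs ?_⟩
  intro c hc
  have h3 : (m : ℝ) * s ≤ c.card := by
    have h4 := hbig' c hc
    nlinarith
  exact_mod_cast h3

/-- The lines of a line system with `m` lines on each vertex form a partial geometry. -/
theorem exists_finitePG {F : Finset (Finset V)} (hF : LineSystem G F)
    (hD : ∀ x, (F.filter (x ∈ ·)).card = m) (hne : ∃ x y, x ≠ y ∧ ¬ G.Adj x y) :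
    ∃ K e : ℕ, FinitePG (fun (p : V) (c : F) => p ∈ (c : Finset V)) K m e ∧ m * e = μ ∧
      m * K = k + m := by
  obtain ⟨x, y, hxy, hn⟩ := hne
  have hm := h.two_le
  have hdel : ∀ c ∈ F, ∀ p ∈ c, m * c.card = k + m := fun c hc p hp =>
    h.delsarte_of_card_lines_eq hF (hD p) hc hp
  obtain ⟨c₀, hc₀⟩ : (F.filter (x ∈ ·)).Nonempty := card_pos.1 (by rw [hD]; omega)
  rw [mem_filter] at hc₀
  have hK := hdel c₀ hc₀.1 x hc₀.2
  have hyc : y ∉ c₀ := fun hy => hn ((hF.maxClique c₀ hc₀.1).1 x hc₀.2 y hy hxy)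
  have hne : ∀ c ∈ F, c.Nonempty := by
    intro c hc
    rw [nonempty_iff_ne_empty]
    rintro rfl
    obtain ⟨w, hw, -⟩ := (hF.maxClique ∅ hc).2 x (by simp)
    simp at hw
  have hcard : ∀ c ∈ F, c.card = c₀.card := by
    intro c hc
    obtain ⟨p, hp⟩ := hne c hc
    exact Nat.eq_of_mul_eq_mul_left (show 0 < m by omega) ((hdel c hc p hp).trans hK.symm)
  have he := h.card_nbr_delsarte c₀ (hF.maxClique c₀ hc₀.1).1 hK y hyc
  set e := (G.neighborFinset y ∩ c₀).card
  have hmeet : ∀ (a : F) (p : V), p ∉ (a : Finset V) →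
      (univ.filter fun b : F => p ∈ (b : Finset V) ∧
        ∃ q, q ∈ (b : Finset V) ∧ q ∈ (a : Finset V)).card = e := by
    intro a p hp
    obtain ⟨z, hz⟩ := hne a a.2
    have h1 := h.card_nbr_delsarte a (hF.maxClique a a.2).1 (hdel a a.2 z hz) p hp
    rw [← he] at h1
    rw [← Nat.eq_of_mul_eq_mul_left (show 0 < m by omega) h1]
    -- Split the neighbours of `p` on `a` by the lines through `p`: each such line that meets `a`
    -- contributes exactly one.
    have h2 := hF.sum_neighborFinset (fun y => if y ∈ (a : Finset V) then 1 else 0) p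
    rw [← card_filter, filter_mem_eq_inter] at h2
    rw [h2]
    have h3 : ∀ c ∈ F.filter (p ∈ ·), ∑ y ∈ c.erase p, (if y ∈ (a : Finset V) then 1 else 0) =
        if ∃ q, q ∈ c ∧ q ∈ (a : Finset V) then 1 else 0 := by
      intro c hc
      rw [mem_filter] at hc
      rw [← card_filter]
      split_ifs with hq
      · obtain ⟨q, hqc, hqa⟩ := hq
        rw [card_eq_one]
        refine ⟨q, eq_singleton_iff_unique_mem.2 ⟨?_, ?_⟩⟩
        · exact mem_filter.2 ⟨mem_erase.2 ⟨fun hqp => hp (hqp ▸ hqa), hqc⟩, hqa⟩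
        · intro w hw
          rw [mem_filter, mem_erase] at hw
          by_contra hwq
          apply hp
          rw [← hF.unique w q hwq c hc.1 a a.2 hw.1.2 hqc hw.2 hqa]
          exact hc.2
      · rw [card_eq_zero, filter_eq_empty_iff]
        intro w hw hwa
        exact hq ⟨w, mem_of_mem_erase hw, hwa⟩
    rw [sum_congr rfl h3, ← card_filter, filter_filter, ← card_map (Function.Embedding.subtype _)]
    congr 1
    ext c
    simp
    tauto
  have hpt : ∀ p : V, (univ.filter fun c : F => p ∈ (c : Finset V)).card = m := by
    intro p
    rw [← hD p, ← card_map (Function.Embedding.subtype _)]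
    congr 1
    ext c
    simp [and_comm]
  refine ⟨c₀.card, e, ⟨?_, ?_, hpt, fun a p hp => by convert hmeet a p hp, ⟨⟨c₀, hc₀.1⟩⟩, ?_, ?_,
    hm, ?_⟩, he, hK⟩
  · intro p q hpq a b hpa hqa hpb hqb
    exact Subtype.ext (hF.unique p q hpq a a.2 b b.2 hpa hqa hpb hqb)
  · intro a
    rw [← hcard a a.2]
    congr 1
    ext; simp
  · by_contra! hcon
    have h1 := Nat.mul_le_mul_left m hcon
    have := h.k_pos
    omega
  · by_contra! hcon
    have := h.mu_pos
    rw [Nat.le_zero.1 hcon] at he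
    omega
  · rw [← hmeet ⟨c₀, hc₀.1⟩ y hyc, ← hpt y]
    refine card_le_card fun b hb => ?_
    simp only [mem_filter, mem_univ, true_and] at hb ⊢
    exact hb.1

end SpectralData

end Setup

/-- If `l` exceeds the bound, then the graph is the collinearity graph of a partial geometry with
`T = R` or `T = R - 1`. -/
theorem IsPrimitiveSRG.geometric {V : Type*} [Fintype V] [DecidableEq V] {G : SimpleGraph V}
    [DecidableRel G.Adj] {v k l μ m : ℕ} (hG : IsPrimitiveSRG G v k l μ)
    (hm : 0 < m) (hmin : IsSmallestEigenvalue G (-(m : ℝ))) (hf : f m μ < l) :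
    ∃ (F : Finset (Finset V)) (K e : ℕ),
      FinitePG (fun (p : V) (c : F) => p ∈ (c : Finset V)) K m e ∧
      (∀ p q, G.Adj p q ↔ p ≠ q ∧ ∃ c : F, p ∈ (c : Finset V) ∧ q ∈ (c : Finset V)) ∧
      m * e = μ ∧ (K : ℤ) = l - m * e + e + m + 1 ∧ (e + 1 = m ∨ e = m) := by
  have h := hG.spectralData hm hmin hf
  obtain ⟨x, y, z, -, -, hxz, hn⟩ := exists_induced_path hG.connected hG.ne_top
  obtain ⟨F, hF, hD⟩ := h.exists_lines hf ⟨x, z, hxz, hn⟩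
  obtain ⟨K, e, hpg, he, hK⟩ := h.exists_finitePG hF hD ⟨x, z, hxz, hn⟩
  have hKl : (K : ℤ) = l - m * e + e + m + 1 := by
    have h1 : (k : ℤ) = μ + m * (l - μ + m) := by exact_mod_cast h.k_eq
    have h2 : (m : ℤ) * K = k + m := by exact_mod_cast hK
    rw [h1, ← he] at h2
    push_cast at h2
    apply mul_left_cancel₀ (show (m : ℤ) ≠ 0 by omega)
    rw [h2]
    ring
  refine ⟨F, K, e, hpg, ?_, he, hKl, ?_⟩
  · intro p q
    constructor
    · intro hpq
      obtain ⟨c, hc, hp, hq⟩ := hF.cover p q hpq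
      exact ⟨hpq.ne, ⟨c, hc⟩, hp, hq⟩
    · rintro ⟨hne, c, hp, hq⟩
      exact (hF.maxClique c c.2).1 p hp q hq hne
  · by_contra! hcon
    have hle := hpg.T_le
    have hT2 : e + 2 ≤ m := by omega
    have h1 := hpg.K_le hT2
    have h1' : (K : ℝ) ≤ 2 * m ^ 2 * e := by exact_mod_cast h1
    have h2 : (K : ℝ) = l - m * e + e + m + 1 := by exact_mod_cast hKl
    have h3 : (1 : ℝ) ≤ e := by exact_mod_cast hpg.T_pos
    have h4 : (e : ℝ) + 2 ≤ m := by exact_mod_cast hT2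
    rw [f, ← he] at hf
    push_cast at hf
    -- Here `e ≥ 1` and `e + 2 ≤ m` force `m ≥ 3`. A third of this quantity is the order-`me` part
    -- of the excess of `K` over `2m²e`; the rest of the excess is positive.
    have h5 : 0 ≤ (m : ℝ) * e * (2 * m - 5) := by
      apply mul_nonneg (mul_nonneg _ _) <;> linarith
    nlinarith

end SRGBound

theorem theorem1p2 {V : Type*} [Fintype V] [DecidableEq V] (G : SimpleGraph V)
    [DecidableRel G.Adj] (v k l μ m : ℕ) (hG : SRGBound.IsPrimitiveSRG G v k l μ)
    (hm : 0 < m) (hmin : SRGBound.IsSmallestEigenvalue G (-(m : ℝ))) :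
    ((μ : ℤ) = (m : ℤ) * ((m : ℤ) - 1) → SRGBound.f m μ < (l : ℝ) →
      (∃ K R T : ℕ, (T : ℤ) = (R : ℤ) - 1 ∧ SRGBound.IsCollinearityGraph G K R T) ∧
      ∃ n : ℕ, (n : ℤ) = (l : ℤ) - (m : ℤ) * ((m : ℤ) - 3) ∧
        SRGBound.IsLatinSquareGraph G m n) ∧
    ((μ : ℤ) = (m : ℤ) ^ 2 → SRGBound.f m μ < (l : ℝ) →
      (∃ K R T : ℕ, T = R ∧ SRGBound.IsCollinearityGraph G K R T) ∧
      ∃ w : ℕ, (w : ℤ) = (l : ℤ) * ((m : ℤ) - 1)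
          - (m : ℤ) * ((m : ℤ) - 1) * ((m : ℤ) - 2) + (m : ℤ) ∧
        SRGBound.IsBlockGraph G w m 1) ∧
    ((μ : ℤ) ≠ (m : ℤ) * ((m : ℤ) - 1) → (μ : ℤ) ≠ (m : ℤ) ^ 2 →
      (l : ℝ) ≤ SRGBound.f m μ) := by
  have hm0 : (m : ℤ) ≠ 0 := by omega
  refine ⟨fun hμ hf => ?_, fun hμ hf => ?_, fun h1 h2 => ?_⟩
  · obtain ⟨F, K, e, hpg, hadj, he, hK, -⟩ := hG.geometric hm hmin hf
    have he' : (e : ℤ) = m - 1 := by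
      apply mul_left_cancel₀ hm0
      rw [← hμ]
      exact_mod_cast he
    refine ⟨⟨K, m, e, he', hpg.isCollinearityGraph hadj⟩, K, ?_,
      hpg.isLatinSquareGraph (by omega) hadj⟩
    rw [hK, he']
    ring
  · obtain ⟨F, K, e, hpg, hadj, he, hK, -⟩ := hG.geometric hm hmin hf
    have he' : (e : ℤ) = m := by
      apply mul_left_cancel₀ hm0
      rw [← sq, ← hμ]
      exact_mod_cast he
    obtain rfl : e = m := by exact_mod_cast he'
    refine ⟨⟨K, e, e, rfl, hpg.isCollinearityGraph hadj⟩, _, ?_, hpg.isBlockGraph hadj⟩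
    push_cast [Nat.cast_sub hpg.one_lt_K.le, Nat.cast_sub hpg.one_lt_R.le]
    rw [hK]
    ring
  · by_contra! hf
    obtain ⟨F, K, e, -, -, he, -, hem⟩ := hG.geometric hm hmin hf
    rcases hem with hem | hem
    · apply h1
      rw [← he, ← hem]
      push_cast
      ring
    · apply h2
      rw [← he, hem]
      push_cast
      ring
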